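/- Let $X$ be a complex manifold and $n\ge 0$. Let $Af_n(\mathbb C)\subset GL_{n+1}(\mathbb C)$ be the affine group, i.e. the group of block matrices $\begin{pmatrix}A&t\\0&1\end{pmatrix}$ with $A\in GL_n(\mathbb C)$ and $t\in\mathbb C^n$. Consider pairs $(\mathcal E,\chi)$, where $\mathcal E$ is a holomorphic vector bundle of rank $n$ on $X$ and $\chi\in H^1(X,\mathcal E)$ (cohomology of the sheaf of holomorphic sections, $H^1(X,\mathcal E)=\operatorname{Ext}^1(\mathcal O_X,\mathcal E)$); an isomorphism $(\mathcal E,\chi)\to(\mathcal E',\chi')$ is an isomorphism of holomorphic vector bundles $\varphi:\mathcal E\to\mathcal E'$ such that $H^1(\varphi)(\chi)=\chi'$. To a holomorphic principal $Af_n(\mathbb C)$-bundle $P$ on $X$ one attaches the associated bundle $\mathcal F=P\times_{Af_n(\mathbb C)}\mathbb C^{n+1}$ of rank $n+1$. The last coordinate of $\mathbb C^{n+1}$ induces a surjection $\mathcal F\to\mathcal O_X$, whose kernel $\mathcal E$ is a vector bundle of rank $n$; this gives an extension $0\to\mathcal E\to\mathcal F\to\mathcal O_X\to 0$, and we let $\chi\in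 H^1(X,\mathcal E)$ be its class, i.e. the image of $1\in H^0(X,\mathcal O_X)$ under the connecting homomorphism. Then $P\mapsto(\mathcal E,\chi)$ induces a bijection between the set of isomorphism classes of holomorphic principal $Af_n(\mathbb C)$-bundles on $X$ and the set of isomorphism classes of pairs $(\mathcal E,\chi)$. -/

import Mathlib

open scoped Manifold ContDiff Bundle
open CategoryTheory TopologicalSpace Bundle

universe u v v' w

namespace AffineBundle

/-! ### Holomorphic vector bundles

Throughout, `X` is a complex manifold modelled on the complex vector space `B`, and
"holomorphic" is expressed as `ContMDiff ω` over `ℂ`, i.e. complex analytic. -/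

/-- A holomorphic vector bundle on `X` with typical fibre `F`. -/
structure HolVB (B : Type w) [NormedAddCommGroup B] [NormedSpace ℂ B]
    (X : Type u) [TopologicalSpace X] [ChartedSpace B X]
    (F : Type) [NormedAddCommGroup F] [NormedSpace ℂ F] where
  /-- the fibres -/
  E : X → Type v
  [addCommGroup : ∀ x, AddCommGroup (E x)]
  [module : ∀ x, Module ℂ (E x)]
  [topFibre : ∀ x, TopologicalSpace (E x)]
  [topTotal : TopologicalSpace (TotalSpace F E)]
  [fiberBundle : FiberBundle F E]
  [vectorBundle : VectorBundle ℂ F E]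
  [holomorphic : ContMDiffVectorBundle ω F E 𝓘(ℂ, B)]

attribute [instance] HolVB.addCommGroup HolVB.module HolVB.topFibre HolVB.topTotal
  HolVB.fiberBundle HolVB.vectorBundle HolVB.holomorphic

section VectorBundles

variable {B : Type w} [NormedAddCommGroup B] [NormedSpace ℂ B]
  {X : Type u} [TopologicalSpace X] [ChartedSpace B X]
  {F : Type} [NormedAddCommGroup F] [NormedSpace ℂ F]
  {F' : Type} [NormedAddCommGroup F'] [NormedSpace ℂ F']
  {F'' : Type} [NormedAddCommGroup F''] [NormedSpace ℂ F'']

/-- The total space of a holomorphic vector bundle. -/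
abbrev HolVB.Total (V : HolVB.{u, v} B X F) := TotalSpace F V.E

/-- A morphism of holomorphic vector bundles over `X`: a holomorphic map of total spaces which
is fibrewise linear over the identity of `X`. -/
@[ext]
structure HolVB.Hom (V : HolVB.{u, v} B X F) (V' : HolVB.{u, v'} B X F') where
  /-- the linear maps between the fibres -/
  lin : ∀ x, V.E x →ₗ[ℂ] V'.E x
  holomorphic' : ContMDiff (𝓘(ℂ, B).prod 𝓘(ℂ, F)) (𝓘(ℂ, B).prod 𝓘(ℂ, F')) ω
    (fun z : V.Total => (⟨z.proj, lin z.proj z.snd⟩ : V'.Total))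

/-- Holomorphic vector bundles with typical fibre `F` on `X` form a category. -/
instance : Category (HolVB.{u, v} B X F) where
  Hom V V' := HolVB.Hom V V'
  id V := ⟨fun _ => LinearMap.id, contMDiff_id⟩
  comp f g := ⟨fun x => (g.lin x).comp (f.lin x), g.holomorphic'.comp f.holomorphic'⟩

/-- The trivial line bundle. -/
noncomputable def trivialLine (B : Type w) [NormedAddCommGroup B] [NormedSpace ℂ B]
    (X : Type u) [TopologicalSpace X] [ChartedSpace B X] : HolVB.{u, 0} B X ℂ where
  E := Bundle.Trivial X ℂ

/-! ### The sheaf of holomorphic sections -/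

/-- A section of `V` over the open set `U` is holomorphic. -/
def HolVB.IsHolSection (V : HolVB.{u, v} B X F) (U : Opens X) (s : ∀ x : U, V.E x) : Prop :=
  ContMDiff 𝓘(ℂ, B) (𝓘(ℂ, B).prod 𝓘(ℂ, F)) ω (fun x : U => (⟨x, s x⟩ : V.Total))

theorem HolVB.IsHolSection.zero (V : HolVB.{u, v} B X F) (U : Opens X) :
    V.IsHolSection U 0 :=
  (Bundle.contMDiff_zeroSection ℂ V.E (n := ω) (IB := 𝓘(ℂ, B)) (F := F)).comp
    contMDiff_subtype_val

theorem HolVB.IsHolSection.add {V : HolVB.{u, v} B X F} {U : Opens X} {s t : ∀ x : U, V.E x}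
    (hs : V.IsHolSection U s) (ht : V.IsHolSection U t) : V.IsHolSection U (s + t) := by
  intro x₀
  have h1 := contMDiffAt_totalSpace.1 (hs x₀)
  have h2 := contMDiffAt_totalSpace.1 (ht x₀)
  refine contMDiffAt_totalSpace.2 ⟨h1.1, (h1.2.add h2.2).congr_of_eventuallyEq ?_⟩
  have hmem := continuous_subtype_val.continuousAt.preimage_mem_nhds
    ((trivializationAt F V.E x₀.1).open_baseSet.mem_nhds
      (mem_baseSet_trivializationAt F V.E x₀.1))
  filter_upwards [hmem] with x hx
  exact ((trivializationAt F V.E x₀.1).linear ℂ hx).1 (s x) (t x)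

theorem HolVB.IsHolSection.neg {V : HolVB.{u, v} B X F} {U : Opens X} {s : ∀ x : U, V.E x}
    (hs : V.IsHolSection U s) : V.IsHolSection U (-s) := by
  intro x₀
  have h1 := contMDiffAt_totalSpace.1 (hs x₀)
  refine contMDiffAt_totalSpace.2 ⟨h1.1, h1.2.neg.congr_of_eventuallyEq ?_⟩
  have hmem := continuous_subtype_val.continuousAt.preimage_mem_nhds
    ((trivializationAt F V.E x₀.1).open_baseSet.mem_nhds
      (mem_baseSet_trivializationAt F V.E x₀.1))
  filter_upwards [hmem] with x hx
  exact ((trivializationAt F V.E x₀.1).linear ℂ hx).map_neg (s x)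

theorem HolVB.IsHolSection.res {V : HolVB.{u, v} B X F} {U U' : Opens X} (h : U' ≤ U)
    {s : ∀ x : U, V.E x} (hs : V.IsHolSection U s) :
    V.IsHolSection U' (fun x => s (Opens.inclusion h x)) :=
  ContMDiff.comp hs (contMDiff_inclusion h)

/-- Holomorphy of sections is a local condition. -/
noncomputable def HolVB.holPredicate (V : HolVB.{u, v} B X F) :
    TopCat.LocalPredicate (X := TopCat.of X) V.E where
  pred s := V.IsHolSection _ s
  res {_ _} i _ hs := HolVB.IsHolSection.res (leOfHom i) hs
  locality s h := by
    intro x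
    obtain ⟨U', hx, i, hs⟩ := h x
    exact ((contDiffWithinAt_localInvariantProp (I := 𝓘(ℂ, B))
      (I' := 𝓘(ℂ, B).prod 𝓘(ℂ, F)) ω).liftPropAt_iff_comp_inclusion (leOfHom i)
        (fun x => (⟨x.1, s x⟩ : V.Total)) ⟨x.1, hx⟩).2 (hs ⟨x.1, hx⟩)

/-- The additive group of holomorphic sections of `V` over `U`. -/
noncomputable def HolVB.sections (V : HolVB.{u, v} B X F) (U : Opens X) : AddSubgroup (∀ x : U, V.E x) where
  carrier := {s | V.IsHolSection U s}
  zero_mem' := HolVB.IsHolSection.zero V U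
  add_mem' := HolVB.IsHolSection.add
  neg_mem' := HolVB.IsHolSection.neg

/-- The presheaf of holomorphic sections of `V`, with the restriction maps. -/
noncomputable def HolVB.presheaf (V : HolVB.{u, v} B X F) :
    TopCat.Presheaf AddCommGrpCat.{max u v} (TopCat.of X) where
  obj U := AddCommGrpCat.of (V.sections U.unop)
  map i := AddCommGrpCat.ofHom
    { toFun := fun s => ⟨fun x => s.1 (Opens.inclusion (leOfHom i.unop) x),
        HolVB.IsHolSection.res (leOfHom i.unop) s.2⟩
      map_zero' := rfl
      map_add' := fun _ _ => rfl }

/-- The sheaf of holomorphic sections of `V`. -/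
noncomputable def HolVB.sheaf (V : HolVB.{u, v} B X F) :
    TopCat.Sheaf AddCommGrpCat.{max u v} (TopCat.of X) where
  obj := V.presheaf
  property := by
    refine (TopCat.Presheaf.isSheaf_iff_isSheaf_comp' (forget AddCommGrpCat) V.presheaf).2 ?_
    exact (TopCat.subsheafToTypes V.holPredicate).property

/-- The map on holomorphic sections induced by a morphism of vector bundles. -/
noncomputable def HolVB.Hom.sheafMap {V : HolVB.{u, v} B X F} {V' : HolVB.{u, v} B X F'}
    (f : HolVB.Hom V V') :
    V.sheaf ⟶ V'.sheaf :=
  ObjectProperty.homMk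
    { app := fun _ => AddCommGrpCat.ofHom
        { toFun := fun s => ⟨fun x => f.lin x (s.1 x), f.holomorphic'.comp s.2⟩
          map_zero' := Subtype.ext (funext fun x => map_zero (f.lin x))
          map_add' := fun s t => Subtype.ext (funext fun x => map_add (f.lin x) (s.1 x) (t.1 x)) }
      naturality := fun _ _ _ => rfl }

/-- The structure sheaf `𝓞_X`, the sheaf of holomorphic sections of the trivial line bundle. -/
noncomputable def structureSheaf (B : Type w) [NormedAddCommGroup B] [NormedSpace ℂ B]
    (X : Type u) [TopologicalSpace X] [ChartedSpace B X] :
    Sheaf (Opens.grothendieckTopology (TopCat.of X)) AddCommGrpCat.{u} :=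
  (trivialLine B X).sheaf

/-- The map from the sheaf of holomorphic sections of `V` to the structure sheaf `𝓞_X` induced by
a morphism from `V` to the trivial line bundle. -/
noncomputable def HolVB.Hom.sheafMapToTrivial {V : HolVB.{u, u} B X F}
    (f : HolVB.Hom V (trivialLine B X)) :
    V.sheaf ⟶ structureSheaf B X :=
  ObjectProperty.homMk
    { app := fun _ => AddCommGrpCat.ofHom
        { toFun := fun s => ⟨fun x => f.lin x (s.1 x), f.holomorphic'.comp s.2⟩
          map_zero' := Subtype.ext (funext fun x => map_zero (f.lin x))
          map_add' := fun s t => Subtype.ext (funext fun x => map_add (f.lin x) (s.1 x) (t.1 x)) }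
      naturality := fun _ _ _ => rfl }

/-- The functor sending a holomorphic vector bundle to its sheaf of holomorphic sections. -/
noncomputable def sheafFunctor (B : Type w) [NormedAddCommGroup B] [NormedSpace ℂ B]
    (X : Type u) [TopologicalSpace X] [ChartedSpace B X]
    (F : Type) [NormedAddCommGroup F] [NormedSpace ℂ F] :
    HolVB.{u, u} B X F ⥤ Sheaf (Opens.grothendieckTopology (TopCat.of X)) AddCommGrpCat.{u} where
  obj V := V.sheaf
  map f := HolVB.Hom.sheafMap f
  map_id _ := rfl
  map_comp _ _ := rfl

/-- The first sheaf cohomology `H¹(X, 𝓔)` as a functor of the holomorphic vector bundle `𝓔`. -/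
noncomputable def H1 (B : Type w) [NormedAddCommGroup B] [NormedSpace ℂ B]
    (X : Type u) [TopologicalSpace X] [ChartedSpace B X]
    (F : Type) [NormedAddCommGroup F] [NormedSpace ℂ F] : HolVB.{u, u} B X F ⥤ Type u :=
  sheafFunctor B X F ⋙ Sheaf.functorH (Opens.grothendieckTopology (TopCat.of X)) 1 ⋙
    forget AddCommGrpCat

/-- The category of pairs `(𝓔, χ)`, where `𝓔` is a holomorphic vector bundle of rank `n` on `X`
and `χ ∈ H¹(X, 𝓔)`; a morphism `(𝓔, χ) ⟶ (𝓔', χ')` is a morphism `φ : 𝓔 ⟶ 𝓔'` of vector bundles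
such that `H¹(φ)` sends `χ` to `χ'`. -/
abbrev Pairs (B : Type w) [NormedAddCommGroup B] [NormedSpace ℂ B]
    (X : Type u) [TopologicalSpace X] [ChartedSpace B X] (n : ℕ) :=
  (H1 B X (Fin n → ℂ)).Elements

end VectorBundles

/-! ### The affine group -/

/-- The affine group `Af_n(ℂ)`: pairs `(A, t)` of a linear part `A ∈ GL_n(ℂ)` and a translation
part `t ∈ ℂⁿ`. -/
def Aff (n : ℕ) : Type := ((Fin n → ℂ) →L[ℂ] (Fin n → ℂ))ˣ × (Fin n → ℂ)

namespace Aff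

variable {n : ℕ}

/-- The linear part. -/
noncomputable def lin (g : Aff n) : ((Fin n → ℂ) →L[ℂ] (Fin n → ℂ))ˣ := g.1

/-- The translation part. -/
noncomputable def trans (g : Aff n) : Fin n → ℂ := g.2

/-- The action of the block matrix `(A t; 0 1)` on `ℂⁿ⁺¹ = ℂⁿ × ℂ`. -/
noncomputable def act (g : Aff n) (y : (Fin n → ℂ) × ℂ) : (Fin n → ℂ) × ℂ :=
  (g.lin.1 y.1 + y.2 • g.trans, y.2)

@[ext]
theorem ext {g h : Aff n} (h₁ : g.lin = h.lin) (h₂ : g.trans = h.trans) : g = h :=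
  Prod.ext h₁ h₂

/-- Multiplication of block matrices: `(A t; 0 1) (A' t'; 0 1) = (A A' (A t' + t); 0 1)`. -/
noncomputable instance : Group (Aff n) where
  mul g h := (g.lin * h.lin, g.lin.1 h.trans + g.trans)
  one := (1, 0)
  inv g := (g.lin⁻¹, -(g.lin⁻¹).1 g.trans)
  mul_assoc g h k := Aff.ext (mul_assoc g.lin h.lin k.lin) (by
    change g.lin.1 (h.lin.1 k.trans) + _ = g.lin.1 (h.lin.1 k.trans + h.trans) + g.trans
    rw [map_add, add_assoc]; rfl)
  one_mul g := Aff.ext (one_mul g.lin) (by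
    change g.trans + 0 = g.trans
    rw [add_zero])
  mul_one g := Aff.ext (mul_one g.lin) (by
    change g.lin.1 0 + g.trans = g.trans
    rw [map_zero, zero_add])
  inv_mul_cancel g := Aff.ext (inv_mul_cancel g.lin) (by
    change (g.lin⁻¹).1 g.trans + -(g.lin⁻¹).1 g.trans = 0
    rw [add_neg_cancel])

/-- The block matrix description of the group law: `act` is multiplicative. -/
theorem act_mul (g h : Aff n) (y : (Fin n → ℂ) × ℂ) : (g * h).act y = g.act (h.act y) := by
  refine Prod.ext ?_ rfl
  change g.lin.1 (h.lin.1 y.1) + y.2 • (g.lin.1 h.trans + g.trans) =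
    g.lin.1 (h.lin.1 y.1 + y.2 • h.trans) + y.2 • g.trans
  rw [map_add, map_smul, smul_add, add_assoc]

/-- `Af_n(ℂ)` is a group of linear automorphisms of `ℂⁿ⁺¹`: the action is faithful. -/
theorem act_injective : Function.Injective (act : Aff n → (Fin n → ℂ) × ℂ → (Fin n → ℂ) × ℂ) := by
  intro g h hgh
  refine Aff.ext (Units.ext (ContinuousLinearMap.ext fun v => ?_)) ?_
  · simpa [act] using congrArg Prod.fst (congrFun hgh (v, 0))
  · simpa [act] using congrArg Prod.fst (congrFun hgh (0, 1))

/-- As a complex manifold, `Af_n(ℂ)` is `GL_n(ℂ) × ℂⁿ`. -/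
noncomputable instance : TopologicalSpace (Aff n) :=
  inferInstanceAs (TopologicalSpace (((Fin n → ℂ) →L[ℂ] (Fin n → ℂ))ˣ × (Fin n → ℂ)))

noncomputable instance : ChartedSpace
    (ModelProd ((Fin n → ℂ) →L[ℂ] (Fin n → ℂ)) (Fin n → ℂ)) (Aff n) :=
  inferInstanceAs (ChartedSpace (ModelProd ((Fin n → ℂ) →L[ℂ] (Fin n → ℂ)) (Fin n → ℂ))
    (((Fin n → ℂ) →L[ℂ] (Fin n → ℂ))ˣ × (Fin n → ℂ)))

end Aff

/-- The model space of `Af_n(ℂ)`. -/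
abbrev AffModel (n : ℕ) := ModelProd ((Fin n → ℂ) →L[ℂ] (Fin n → ℂ)) (Fin n → ℂ)

/-- The model with corners of `Af_n(ℂ)`. -/
noncomputable abbrev affI (n : ℕ) :
    ModelWithCorners ℂ (((Fin n → ℂ) →L[ℂ] (Fin n → ℂ)) × (Fin n → ℂ)) (AffModel n) :=
  𝓘(ℂ, (Fin n → ℂ) →L[ℂ] (Fin n → ℂ)).prod 𝓘(ℂ, Fin n → ℂ)

/-! ### Holomorphic principal bundles with structure group the affine group -/

open MulOpposite in
/-- A holomorphic principal `Af_n(ℂ)`-bundle on `X`: a complex manifold `P` with a right action of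
`Af_n(ℂ)` and a projection to `X` which is, locally on `X`, equivariantly biholomorphic to
`U × Af_n(ℂ)` (with `Af_n(ℂ)` acting by right translations) over `U`.  That the action and the
projection are holomorphic follows from local triviality. -/
structure PrincipalAff (B : Type w) [NormedAddCommGroup B] [NormedSpace ℂ B]
    (X : Type u) [TopologicalSpace X] [ChartedSpace B X] (n : ℕ) where
  /-- the total space -/
  P : Type u
  [top : TopologicalSpace P]
  [charted : ChartedSpace (ModelProd B (AffModel n)) P]
  [isManifold : IsManifold (𝓘(ℂ, B).prod (affI n)) ω P]
  /-- the right action -/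
  [action : MulAction (Aff n)ᵐᵒᵖ P]
  /-- the projection -/
  proj : P → X
  proj_smul : ∀ (g : Aff n) (p : P), proj (op g • p) = proj p
  locallyTrivial : ∀ x : X, ∃ U : Set X, IsOpen U ∧ x ∈ U ∧
    ∃ e : OpenPartialHomeomorph P (X × Aff n),
      e.source = proj ⁻¹' U ∧ e.target = U ×ˢ Set.univ ∧
      ContMDiffOn (𝓘(ℂ, B).prod (affI n)) (𝓘(ℂ, B).prod (affI n)) ω e e.source ∧
      ContMDiffOn (𝓘(ℂ, B).prod (affI n)) (𝓘(ℂ, B).prod (affI n)) ω e.symm e.target ∧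
      ∀ p ∈ e.source, (e p).1 = proj p ∧ ∀ g : Aff n, e (op g • p) = ((e p).1, (e p).2 * g)

attribute [instance] PrincipalAff.top PrincipalAff.charted PrincipalAff.isManifold
  PrincipalAff.action

section Principal

variable {B : Type w} [NormedAddCommGroup B] [NormedSpace ℂ B]
  {X : Type u} [TopologicalSpace X] [ChartedSpace B X] {n : ℕ}

/-- A morphism of holomorphic principal `Af_n(ℂ)`-bundles: a holomorphic equivariant map over the
identity of `X`. -/
@[ext]
structure PrincipalAff.Hom (Q Q' : PrincipalAff B X n) where
  /-- the underlying map of total spaces -/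
  toFun : Q.P → Q'.P
  holomorphic : ContMDiff (𝓘(ℂ, B).prod (affI n)) (𝓘(ℂ, B).prod (affI n)) ω toFun
  map_smul : ∀ (g : Aff n) (p : Q.P), toFun (MulOpposite.op g • p) = MulOpposite.op g • toFun p
  map_proj : ∀ p : Q.P, Q'.proj (toFun p) = Q.proj p

/-- Holomorphic principal `Af_n(ℂ)`-bundles on `X` form a category. -/
instance : Category (PrincipalAff B X n) where
  Hom Q Q' := PrincipalAff.Hom Q Q'
  id Q := ⟨id, contMDiff_id, fun _ _ => rfl, fun _ => rfl⟩
  comp f g := ⟨g.toFun ∘ f.toFun, g.holomorphic.comp f.holomorphic,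
    fun a p => by simp only [Function.comp_apply, f.map_smul, g.map_smul],
    fun p => by simp only [Function.comp_apply, f.map_proj, g.map_proj]⟩

end Principal

/-! ### Extensions of the trivial line bundle and the affine bundles they come from -/

section Extensions

variable {B : Type w} [NormedAddCommGroup B] [NormedSpace ℂ B]
  {X : Type u} [TopologicalSpace X] [ChartedSpace B X] {n : ℕ}

/-- An extension `0 ⟶ 𝓔 ⟶ 𝓕 ⟶ 𝓞_X ⟶ 0` of holomorphic vector bundles on `X`, with `𝓔` of rank
`n` and `𝓕` of rank `n + 1`. -/
structure Extension (V : HolVB.{u, u} B X (Fin n → ℂ)) where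
  /-- the bundle in the middle -/
  W : HolVB.{u, u} B X ((Fin n → ℂ) × ℂ)
  /-- the inclusion -/
  i : HolVB.Hom V W
  /-- the projection -/
  p : HolVB.Hom W (trivialLine B X)
  injective : ∀ x, Function.Injective (i.lin x)
  exact : ∀ x, Function.Exact (i.lin x) (p.lin x)
  surjective : ∀ x, Function.Surjective (p.lin x)


namespace HolVB

variable {F : Type} [NormedAddCommGroup F] [NormedSpace ℂ F]
  {F' : Type} [NormedAddCommGroup F'] [NormedSpace ℂ F']

/-- The local section of `V` over a trivializing open set whose coordinates are constant. -/
theorem contMDiffOn_localFrame (V : HolVB.{u, v} B X F) (x₀ : X) {M : Type u}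
    [TopologicalSpace M] [ChartedSpace B M] {a : M → X} {c : M → F} {y : M}
    (ha : ContMDiffAt 𝓘(ℂ, B) 𝓘(ℂ, B) ω a y) (hc : ContMDiffAt 𝓘(ℂ, B) 𝓘(ℂ, F) ω c y)
    (hy : a y ∈ (trivializationAt F V.E x₀).baseSet) :
    ContMDiffAt 𝓘(ℂ, B) (𝓘(ℂ, B).prod 𝓘(ℂ, F)) ω
      (fun x => (⟨a x, (trivializationAt F V.E x₀).symmₗ ℂ (a x) (c x)⟩ : V.Total)) y := by
  have hmem := ha.continuousAt.preimage_mem_nhds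
    ((trivializationAt F V.E x₀).open_baseSet.mem_nhds hy)
  refine ((Trivialization.contMDiffAt_iff (e := trivializationAt F V.E x₀) ?_).2
    ⟨ha, hc.congr_of_eventuallyEq ?_⟩)
  · exact (Trivialization.mem_source _).2 hy
  · filter_upwards [hmem] with x hx
    have := (trivializationAt F V.E x₀).linearMapAt_symmₗ (R := ℂ) hx (c x)
    rwa [(trivializationAt F V.E x₀).coe_linearMapAt_of_mem (R := ℂ) hx] at this

/-- A section of `V` is holomorphic if its image under a fibrewise injective morphism is. -/
theorem Hom.isHolSection_of_injective [FiniteDimensional ℂ F] [FiniteDimensional ℂ F'] {V : HolVB.{u, v} B X F}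
    {V' : HolVB.{u, v'} B X F'} (f : Hom V V') (hf : ∀ x, Function.Injective (f.lin x))
    {U : Opens X} {s : ∀ x : U, V.E x} (hs : V'.IsHolSection U (fun x => f.lin x (s x))) :
    V.IsHolSection U s := by
  intro x₀
  set e := trivializationAt F V.E x₀.1 with he
  set e' := trivializationAt F' V'.E x₀.1 with he'
  have hx₀ : x₀.1 ∈ e.baseSet := mem_baseSet_trivializationAt F V.E x₀.1
  have hx₀' : x₀.1 ∈ e'.baseSet := mem_baseSet_trivializationAt F' V'.E x₀.1
  -- the morphism in coordinates
  let L : U → F →ₗ[ℂ] F' := fun x =>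
    (e'.linearMapAt ℂ x.1).comp ((f.lin x.1).comp (e.symmₗ ℂ x.1))
  have hL : LinearMap.ker (L x₀) = ⊥ := by
    refine LinearMap.ker_eq_bot.2 ?_
    have h1 : Function.Injective (e.symmₗ ℂ x₀.1) :=
      Function.LeftInverse.injective (fun y => e.linearMapAt_symmₗ hx₀ y)
    have h2 : Function.Injective (e'.linearMapAt ℂ x₀.1) :=
      Function.LeftInverse.injective (fun y => e'.symmₗ_linearMapAt hx₀' y)
    exact h2.comp ((hf x₀.1).comp h1)
  obtain ⟨R, hR⟩ := (L x₀).exists_leftInverse_of_injective hL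
  let Rc : F' →L[ℂ] F := LinearMap.toContinuousLinearMap R
  let M : U → F →L[ℂ] F := fun x => LinearMap.toContinuousLinearMap (R.comp (L x))
  have hM₀ : M x₀ = 1 := by
    ext v
    exact LinearMap.congr_fun hR v
  have hmem := continuous_subtype_val.continuousAt.preimage_mem_nhds
    (e.open_baseSet.mem_nhds hx₀)
  have hmem' := continuous_subtype_val.continuousAt.preimage_mem_nhds
    (e'.open_baseSet.mem_nhds hx₀')
  -- the coordinates of a section of `V'`, projected to `F` by `R`
  have hcoord : ∀ t : ∀ x : U, V'.E x,
      ContMDiffAt 𝓘(ℂ, B) (𝓘(ℂ, B).prod 𝓘(ℂ, F')) ω (fun x : U => (⟨x, t x⟩ : V'.Total)) x₀ →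
      ContMDiffAt 𝓘(ℂ, B) 𝓘(ℂ, F) ω (fun x : U => R (e'.linearMapAt ℂ x.1 (t x))) x₀ := by
    intro t ht
    have h1 := (Trivialization.contMDiffAt_iff (e := e')
      ((Trivialization.mem_source _).2 hx₀')).1 ht
    have h2 : ContMDiffAt 𝓘(ℂ, B) 𝓘(ℂ, F) ω (fun x : U => Rc (e' ⟨x.1, t x⟩).2) x₀ :=
      Rc.contMDiff.contMDiffAt.comp x₀ h1.2
    refine h2.congr_of_eventuallyEq ?_
    filter_upwards [hmem'] with x hx
    rw [e'.coe_linearMapAt_of_mem (R := ℂ) hx]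
    rfl
  have hMv : ∀ v : F, ContMDiffAt 𝓘(ℂ, B) 𝓘(ℂ, F) ω (fun x => M x v) x₀ := by
    intro v
    refine hcoord (fun x => f.lin x.1 (e.symmₗ ℂ x.1 v)) ?_
    exact f.holomorphic'.contMDiffAt.comp x₀ (V.contMDiffOn_localFrame x₀.1
      contMDiff_subtype_val.contMDiffAt (contMDiffAt_const (c := v)) hx₀)
  have hM : ContMDiffAt 𝓘(ℂ, B) 𝓘(ℂ, F →L[ℂ] F) ω M x₀ := by
    let b := Module.finBasis ℂ F
    let P : Fin (Module.finrank ℂ F) → F →L[ℂ] F →L[ℂ] F := fun j =>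
      ContinuousLinearMap.smulRightL ℂ F F (LinearMap.toContinuousLinearMap (b.coord j))
    have h1 : ContMDiffAt 𝓘(ℂ, B) 𝓘(ℂ, F →L[ℂ] F) ω (fun x => ∑ j, P j (M x (b j))) x₀ := by
      refine contMDiffAt_finsetSum fun j _ => ?_
      exact (P j).contMDiff.contMDiffAt.comp x₀ (hMv (b j))
    refine h1.congr_of_eventuallyEq (Filter.Eventually.of_forall fun x => ?_)
    ext v
    conv_lhs => rw [← b.sum_repr v, map_sum]
    simp [P]
  have hinv : ContMDiffAt 𝓘(ℂ, B) 𝓘(ℂ, F →L[ℂ] F) ω (fun x => Ring.inverse (M x)) x₀ := by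
    have h1 : ContDiffAt ℂ ω Ring.inverse (M x₀) := by
      have := contDiffAt_ringInverse ℂ (n := ω) (1 : (F →L[ℂ] F)ˣ)
      rwa [Units.val_one, ← hM₀] at this
    exact h1.contMDiffAt.comp x₀ hM
  have hunit : ∀ᶠ x in nhds x₀, IsUnit (M x) := by
    have h1 : {T : F →L[ℂ] F | IsUnit T} ∈ nhds (M x₀) :=
      Units.isOpen.mem_nhds (by rw [hM₀]; exact isUnit_one)
    exact hM.continuousAt h1
  refine (Trivialization.contMDiffAt_iff (e := e) ((Trivialization.mem_source _).2 hx₀)).2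
    ⟨contMDiff_subtype_val.contMDiffAt, ?_⟩
  refine (hinv.clm_apply (hcoord _ (hs x₀))).congr_of_eventuallyEq ?_
  filter_upwards [hmem, hunit] with x hx hu
  have h1 : R (e'.linearMapAt ℂ x.1 (f.lin x.1 (s x))) = M x (e.linearMapAt ℂ x.1 (s x)) := by
    change _ = R (e'.linearMapAt ℂ x.1 (f.lin x.1 (e.symmₗ ℂ x.1 (e.linearMapAt ℂ x.1 (s x)))))
    rw [e.symmₗ_linearMapAt hx]
  rw [h1, ← mul_apply_eq_comp, Ring.inverse_mul_cancel _ hu,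
    e.coe_linearMapAt_of_mem (R := ℂ) hx]
  rfl

/-- Local surjectivity on holomorphic sections of a fibrewise surjective morphism to the trivial
line bundle. -/
theorem Hom.exists_local_lift {V : HolVB.{u, v} B X F} (f : Hom V (trivialLine B X))
    (hf : ∀ x, Function.Surjective (f.lin x)) {U : Opens X}
    {t : ∀ x : U, (trivialLine B X).E x} (ht : (trivialLine B X).IsHolSection U t) (x₀ : U) :
    ∃ (U' : Opens X) (h : U' ≤ U), x₀.1 ∈ U' ∧ ∃ s : ∀ x : U', V.E x, V.IsHolSection U' s ∧
      ∀ x : U', f.lin x (s x) = t (Opens.inclusion h x) := by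
  set e := trivializationAt F V.E x₀.1 with he
  have hx₀ : x₀.1 ∈ e.baseSet := mem_baseSet_trivializationAt F V.E x₀.1
  obtain ⟨y, hy⟩ := hf x₀.1 (1 : ℂ)
  let c : F := e.linearMapAt ℂ x₀.1 y
  let g : X → ℂ := fun x => f.lin x (e.symmₗ ℂ x c)
  have hg₀ : g x₀.1 ≠ 0 := by
    have : g x₀.1 = 1 := by
      change f.lin x₀.1 (e.symmₗ ℂ x₀.1 (e.linearMapAt ℂ x₀.1 y)) = (1 : ℂ)
      rw [e.symmₗ_linearMapAt hx₀, hy]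
    rw [this]
    exact one_ne_zero
  have hg : ∀ x ∈ e.baseSet, ContMDiffAt 𝓘(ℂ, B) 𝓘(ℂ, ℂ) ω g x := fun x hx =>
    (contMDiffAt_totalSpace.1 (f.holomorphic'.contMDiffAt.comp x
      (V.contMDiffOn_localFrame x₀.1 contMDiffAt_id (contMDiffAt_const (c := c)) hx))).2
  have hgc : ContinuousOn g e.baseSet := fun x hx => (hg x hx).continuousAt.continuousWithinAt
  let U' : Opens X := U ⊓ ⟨e.baseSet ∩ g ⁻¹' {0}ᶜ,
    hgc.isOpen_inter_preimage e.open_baseSet isOpen_compl_singleton⟩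
  have hU : U' ≤ U := inf_le_left
  let t' : U' → ℂ := fun x => t (Opens.inclusion hU x)
  refine ⟨U', hU, ⟨x₀.2, hx₀, hg₀⟩,
    fun x => e.symmₗ ℂ x.1 (((g x.1)⁻¹ * t' x) • c), ?_, ?_⟩
  · intro x
    have ht' : ContMDiffAt 𝓘(ℂ, B) 𝓘(ℂ, ℂ) ω t' x :=
      (contMDiffAt_totalSpace.1 (ht.res hU x)).2
    have hgx : ContMDiffAt 𝓘(ℂ, B) 𝓘(ℂ, ℂ) ω (fun x : U' => (g x.1)⁻¹) x :=
      ContMDiffAt.inv₀ ((hg x.1 x.2.2.1).comp x contMDiff_subtype_val.contMDiffAt) x.2.2.2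
    exact V.contMDiffOn_localFrame x₀.1 contMDiff_subtype_val.contMDiffAt
      ((hgx.mul ht').smul contMDiffAt_const) x.2.2.1
  · intro x
    change f.lin x.1 (e.symmₗ ℂ x.1 (((g x.1)⁻¹ * t' x) • c)) = t' x
    rw [map_smul, map_smul]
    change ((g x.1)⁻¹ * t' x) * g x.1 = t' x
    rw [mul_comm, ← mul_assoc, mul_inv_cancel₀ x.2.2.2, one_mul]

end HolVB

/-- The complex of sheaves of holomorphic sections given by an extension. -/
noncomputable def Extension.complex {V : HolVB.{u, u} B X (Fin n → ℂ)} (S : Extension V) :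
    ShortComplex (Sheaf (Opens.grothendieckTopology (TopCat.of X)) AddCommGrpCat.{u}) :=
  ShortComplex.mk (X₁ := V.sheaf) (X₂ := S.W.sheaf) (X₃ := structureSheaf B X)
    S.i.sheafMap S.p.sheafMapToTrivial (by
      refine Sheaf.hom_ext (NatTrans.ext (funext fun U => ?_))
      refine AddCommGrpCat.hom_ext (AddMonoidHom.ext fun s => Subtype.ext (funext fun x => ?_))
      exact (S.exact x.1).apply_apply_eq_zero (s.1 x))

/-- The sequence of sheaves of holomorphic sections given by an extension is exact. -/
theorem Extension.shortExact {V : HolVB.{u, u} B X (Fin n → ℂ)} (S : Extension V) :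
    S.complex.ShortExact := by
  have hmono : Mono S.complex.f := by
    refine Sheaf.mono_of_injective S.i.sheafMap fun U s t h => ?_
    refine Subtype.ext (funext fun x => S.injective x.1 ?_)
    exact congrFun (congrArg Subtype.val h) x
  have hepi : Epi S.complex.g := by
    refine (TopCat.Sheaf.isLocallySurjective_iff_epi S.p.sheafMapToTrivial).1 ?_
    refine (TopCat.Presheaf.isLocallySurjective_iff _).2 fun U t x hx => ?_
    obtain ⟨U', h, hx', s, hs, hst⟩ := S.p.exists_local_lift S.surjective t.2 ⟨x, hx⟩
    exact ⟨U', h, ⟨⟨s, hs⟩, Subtype.ext (funext hst)⟩, hx'⟩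
  refine { exact := ?_ }
  refine ShortComplex.exact_of_f_is_kernel _ ?_
  refine Limits.KernelFork.IsLimit.ofι' _ _ fun {A} k hk => ?_
  have hker : ∀ (U : (Opens (TopCat.of X))ᵒᵖ) (a : A.obj.obj U),
      ∃ s : V.sections U.unop, ∀ x, S.i.lin x.1 (s.1 x) = (k.hom.app U a).1 x := by
    intro U a
    have h0 : ∀ x : U.unop, S.p.lin x.1 ((k.hom.app U a).1 x) = 0 := by
      intro x
      exact congrFun (congrArg Subtype.val (ConcreteCategory.congr_hom
        (NatTrans.congr_app (congrArg (fun φ => φ.hom) hk) U) a)) x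
    choose s hs using fun x : U.unop => (S.exact x.1 _).1 (h0 x)
    refine ⟨⟨s, S.i.isHolSection_of_injective S.injective ?_⟩, hs⟩
    rw [show (fun x => S.i.lin x.1 (s x)) = (k.hom.app U a).1 from funext hs]
    exact (k.hom.app U a).2
  choose l hl using hker
  have hinj : ∀ (U : (Opens (TopCat.of X))ᵒᵖ) (s t : V.sections U.unop),
      (∀ x, S.i.lin x.1 (s.1 x) = S.i.lin x.1 (t.1 x)) → s = t := fun U s t h =>
    Subtype.ext (funext fun x => S.injective x.1 (h x))
  refine ⟨ObjectProperty.homMk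
    { app := fun U => AddCommGrpCat.ofHom
        { toFun := l U
          map_zero' := hinj U _ _ fun x => ?_
          map_add' := fun a b => hinj U _ _ fun x => ?_ }
      naturality := fun U U' j => ?_ }, ?_⟩
  · rw [hl, map_zero]
    exact (map_zero (S.i.lin x.1)).symm
  · rw [hl, map_add]
    exact ((map_add (S.i.lin x.1) _ _).trans (congrArg₂ (· + ·) (hl U a x) (hl U b x))).symm
  · refine AddCommGrpCat.hom_ext (AddMonoidHom.ext fun a => hinj U' _ _ fun x => ?_)
    refine (hl U' _ x).trans ?_
    refine (congrFun (congrArg Subtype.val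
      (ConcreteCategory.congr_hom (k.hom.naturality j) a)) x).trans ?_
    exact (hl U a (Opens.inclusion (leOfHom j.unop) x)).symm
  · refine Sheaf.hom_ext (NatTrans.ext (funext fun U => ?_))
    refine AddCommGrpCat.hom_ext (AddMonoidHom.ext fun a => Subtype.ext (funext fun x => ?_))
    exact hl U a x

/-- The global section `1` of `𝓞_X`. -/
noncomputable def unitSection (B : Type w) [NormedAddCommGroup B] [NormedSpace ℂ B]
    (X : Type u) [TopologicalSpace X] [ChartedSpace B X] :
    (trivialLine B X).sections (⊤ : Opens X) :=
  ⟨fun _ => (1 : ℂ), fun _ => contMDiffAt_totalSpace.2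
    ⟨contMDiff_subtype_val.contMDiffAt, contMDiffAt_const⟩⟩

/-- The class `χ ∈ H¹(X, 𝓔)` of an extension `0 ⟶ 𝓔 ⟶ 𝓕 ⟶ 𝓞_X ⟶ 0`: the image of `1 ∈ H⁰(X, 𝓞_X)`
under the connecting homomorphism `H⁰(X, 𝓞_X) ⟶ H¹(X, 𝓔)`. -/
noncomputable def Extension.cls {V : HolVB.{u, u} B X (Fin n → ℂ)} (S : Extension V) :
    (H1 B X (Fin n → ℂ)).obj V :=
  ((Sheaf.H.equiv₀ (structureSheaf B X) (Limits.isTerminalTop (α := Opens (TopCat.of X)))).symm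
    (unitSection B X)).comp S.shortExact.extClass (zero_add 1)

/-- The extension `0 ⟶ 𝓔 ⟶ 𝓕 ⟶ 𝓞_X ⟶ 0` is the one attached to the principal `Af_n(ℂ)`-bundle `Q`:
`𝓕` is the associated bundle `Q ×_{Af_n(ℂ)} ℂⁿ⁺¹`, i.e. there is a holomorphic map
`ev : Q × ℂⁿ⁺¹ ⟶ 𝓕` over `X`, linear and bijective on fibres, with
`ev (q g, y) = ev (q, (A t; 0 1) y)` for `g = (A, t)`, and the projection `𝓕 ⟶ 𝓞_X` is induced by
the last coordinate of `ℂⁿ⁺¹`.  Hence `𝓔` is the subbundle associated with `ℂⁿ × 0`. -/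
def Extension.IsAssociated {V : HolVB.{u, u} B X (Fin n → ℂ)} (S : Extension V)
    (Q : PrincipalAff B X n) : Prop :=
  ∃ ev : ∀ q : Q.P, ((Fin n → ℂ) × ℂ) ≃ₗ[ℂ] S.W.E (Q.proj q),
    ContMDiff ((𝓘(ℂ, B).prod (affI n)).prod 𝓘(ℂ, (Fin n → ℂ) × ℂ))
      (𝓘(ℂ, B).prod 𝓘(ℂ, (Fin n → ℂ) × ℂ)) ω
      (fun z : Q.P × ((Fin n → ℂ) × ℂ) => (⟨Q.proj z.1, ev z.1 z.2⟩ : S.W.Total)) ∧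
    (∀ (q : Q.P) (g : Aff n) (y : (Fin n → ℂ) × ℂ),
      (⟨Q.proj (MulOpposite.op g • q), ev (MulOpposite.op g • q) y⟩ : S.W.Total) =
        ⟨Q.proj q, ev q (g.act y)⟩) ∧
    ∀ (q : Q.P) (y : (Fin n → ℂ) × ℂ), S.p.lin (Q.proj q) (ev q y) = y.2

end Extensions

end AffineBundle

/-! The affine group is the subgroup of `GL_{n+1}` that preserves the last coordinate
(`Aff.exists_act_eq`, `Aff.act_injective`). A principal bundle is therefore the same thing as an
extension of `𝓞_X`: a point q over x is an isomorphism `ev q` from ℂⁿ × ℂ onto the fibre of 𝓕 at x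
carrying the last coordinate to the projection. Every principal bundle has such an extension
(`PrincipalAff.exists_evaluation`), the extension is determined up to isomorphism together with its
class (`Extension.Evaluation.exists_kernel_iso`), and 𝓕 with its projection determines the principal
bundle (`Extension.Evaluation.nonempty_iso`).

It remains to classify extensions with kernel 𝓔 by H¹(X, 𝓔), which is done with cocycles. Embed the
sheaf 𝓔 in an injective sheaf. A class in H¹ is then the connecting image of a global section of the
quotient, and the differences of local lifts of this section form a cocycle v_ij of sections of 𝓔
(`exists_cocycle`). In trivializations e_i of 𝓔 the pairs (e_i e_j⁻¹, e_i(v_ij)) form an affine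
cocycle, and gluing it realizes the class (`Extension.exists_of_cls`). Conversely, two extensions
with the same class have local lifts of 1 with the same differences (`exists_matching_lifts`). The
identity on 𝓔 together with matching of these lifts glues to an isomorphism of middle terms
(`Extension.exists_hom_of_cls_eq`).

The kernel is determined only up to isomorphism, so the correspondence is treated as a relation
between bundles and pairs, which descends to a bijection of isomorphism classes. -/

namespace AffineBundle

/-! ### Holomorphic families of operators -/

section Calculus

variable {EM : Type*} [NormedAddCommGroup EM] [NormedSpace ℂ EM] {HM : Type*} [TopologicalSpace HM]
  {I : ModelWithCorners ℂ EM HM} {M : Type*} [TopologicalSpace M] [ChartedSpace HM M]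

/-- A family of linear maps on a finite-dimensional space is holomorphic if all its evaluations
are. -/
theorem contMDiffAt_clm_of_apply {F G : Type*} [NormedAddCommGroup F] [NormedSpace ℂ F]
    [FiniteDimensional ℂ F] [NormedAddCommGroup G] [NormedSpace ℂ G] {L : M → F →L[ℂ] G} {x₀ : M}
    (h : ∀ v, ContMDiffAt I 𝓘(ℂ, G) ω (fun x => L x v) x₀) :
    ContMDiffAt I 𝓘(ℂ, F →L[ℂ] G) ω L x₀ := by
  let b := Module.finBasis ℂ F
  -- `P j` sends w to the rank-one operator v ↦ b_j*(v) w, so L x is the sum over j of `P j` at L x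
  -- (b_j).
  let P : Fin (Module.finrank ℂ F) → G →L[ℂ] F →L[ℂ] G := fun j =>
    ContinuousLinearMap.smulRightL ℂ F G (LinearMap.toContinuousLinearMap (b.coord j))
  have h1 : ContMDiffAt I 𝓘(ℂ, F →L[ℂ] G) ω (fun x => ∑ j, P j (L x (b j))) x₀ := by
    refine contMDiffAt_finsetSum fun j _ => ?_
    exact (P j).contMDiff.contMDiffAt.comp x₀ (h (b j))
  refine h1.congr_of_eventuallyEq (Filter.Eventually.of_forall fun x => ?_)
  ext v
  conv_lhs => rw [← b.sum_repr v, map_sum]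
  simp [P]

/-- The only chart of the unit group is its open embedding in the algebra, so reading the map in the
chart is the coercion; continuity passes through the embedding. -/
theorem contMDiffAt_units_iff {R : Type*} [NormedRing R] [CompleteSpace R] [NormedAlgebra ℂ R]
    {f : M → Rˣ} {x₀ : M} :
    ContMDiffAt I 𝓘(ℂ, R) ω f x₀ ↔ ContMDiffAt I 𝓘(ℂ, R) ω (fun x => (f x : R)) x₀ := by
  refine ⟨fun h => Units.contMDiff_val.contMDiffAt.comp x₀ h, fun h => ?_⟩
  refine contMDiffAt_iff_target.2 ⟨?_, h⟩
  exact Units.isOpenEmbedding_val.isInducing.continuousAt_iff.2 h.continuousAt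

/-- The pointwise inverse of a holomorphic family of invertible operators is holomorphic. -/
theorem contMDiffAt_ringInverse {R : Type*} [NormedRing R] [CompleteSpace R] [NormedAlgebra ℂ R]
    {f : M → R} {x₀ : M} (hf : ContMDiffAt I 𝓘(ℂ, R) ω f x₀) (h : IsUnit (f x₀)) :
    ContMDiffAt I 𝓘(ℂ, R) ω (fun x => Ring.inverse (f x)) x₀ := by
  obtain ⟨a, ha⟩ := h
  have h1 : ContDiffAt ℂ ω Ring.inverse (f x₀) := ha ▸ contDiffAt_ringInverse ℂ a
  exact h1.contMDiffAt.comp x₀ hf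

end Calculus

/-! ### The affine group as a holomorphic group of block matrices -/

namespace Aff

variable {n : ℕ}

@[simp] theorem mul_trans (g h : Aff n) : (g * h).trans = g.lin.1 h.trans + g.trans := rfl

@[simp] theorem one_act (y : (Fin n → ℂ) × ℂ) : (1 : Aff n).act y = y := by
  refine Prod.ext ?_ rfl
  change y.1 + y.2 • (0 : Fin n → ℂ) = y.1
  simp

/-- The block matrix `(A t; 0 1)` as a continuous linear operator. -/
noncomputable def actL (g : Aff n) : ((Fin n → ℂ) × ℂ) →L[ℂ] (Fin n → ℂ) × ℂ :=
  (g.lin.1.comp (ContinuousLinearMap.fst ℂ _ _) +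
    (ContinuousLinearMap.snd ℂ (Fin n → ℂ) ℂ).smulRight g.trans).prod
      (ContinuousLinearMap.snd ℂ _ _)

@[simp] theorem actL_apply (g : Aff n) (y : (Fin n → ℂ) × ℂ) : g.actL y = g.act y := rfl

theorem actL_mul (g h : Aff n) : (g * h).actL = g.actL * h.actL :=
  ContinuousLinearMap.ext fun y => act_mul g h y

theorem actL_one : (1 : Aff n).actL = 1 :=
  ContinuousLinearMap.ext fun y => one_act y

/-- The block matrix `(A t; 0 1)` as a linear automorphism. -/
noncomputable def actEquiv (g : Aff n) : ((Fin n → ℂ) × ℂ) ≃ₗ[ℂ] (Fin n → ℂ) × ℂ where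
  __ := g.actL.toLinearMap
  invFun := g⁻¹.act
  left_inv y := by
    change g⁻¹.act (g.act y) = y
    rw [← act_mul, inv_mul_cancel, one_act]
  right_inv y := by
    change g.act (g⁻¹.act y) = y
    rw [← act_mul, mul_inv_cancel, one_act]

/-- The linear automorphisms of `ℂⁿ × ℂ` preserving the last coordinate are the affine ones. -/
theorem exists_act_eq (φ : ((Fin n → ℂ) × ℂ) ≃ₗ[ℂ] (Fin n → ℂ) × ℂ) (h : ∀ y, (φ y).2 = y.2) :
    ∃ g : Aff n, ∀ y, g.act y = φ y := by
  have hs : ∀ y, (φ.symm y).2 = y.2 := fun y => by rw [← h, φ.apply_symm_apply]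
  -- Both φ and its inverse preserve ℂⁿ × 0, so their restrictions to it are mutually inverse and
  -- give the linear part. The translation part is the first component of φ(0, 1).
  let L : (Fin n → ℂ) →L[ℂ] (Fin n → ℂ) := LinearMap.toContinuousLinearMap
    (LinearMap.fst ℂ (Fin n → ℂ) ℂ ∘ₗ φ.toLinearMap ∘ₗ LinearMap.inl ℂ (Fin n → ℂ) ℂ)
  let L' : (Fin n → ℂ) →L[ℂ] (Fin n → ℂ) := LinearMap.toContinuousLinearMap
    (LinearMap.fst ℂ (Fin n → ℂ) ℂ ∘ₗ φ.symm.toLinearMap ∘ₗ LinearMap.inl ℂ (Fin n → ℂ) ℂ)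
  have e : ∀ v, φ (v, 0) = (L v, 0) := fun v => Prod.ext rfl (h _)
  have e' : ∀ v, φ.symm (v, 0) = (L' v, 0) := fun v => Prod.ext rfl (hs _)
  have h1 : L * L' = 1 := ContinuousLinearMap.ext fun v => by
    have := e (L' v)
    rw [← e', φ.apply_symm_apply] at this
    exact (congrArg Prod.fst this).symm
  have h2 : L' * L = 1 := ContinuousLinearMap.ext fun v => by
    have := e' (L v)
    rw [← e, φ.symm_apply_apply] at this
    exact (congrArg Prod.fst this).symm
  refine ⟨(⟨L, L', h1, h2⟩, (φ (0, 1)).1), fun y => ?_⟩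
  have hy : y = (y.1, 0) + y.2 • ((0 : Fin n → ℂ), (1 : ℂ)) := by ext <;> simp
  conv_rhs => rw [hy, map_add, map_smul, e]
  refine Prod.ext rfl ?_
  change y.2 = 0 + y.2 • (φ (0, 1)).2
  rw [h]
  simp

noncomputable instance : IsManifold (affI n) ω (Aff n) :=
  inferInstanceAs (IsManifold
    (𝓘(ℂ, (Fin n → ℂ) →L[ℂ] (Fin n → ℂ)).prod 𝓘(ℂ, Fin n → ℂ)) ω
    (((Fin n → ℂ) →L[ℂ] (Fin n → ℂ))ˣ × (Fin n → ℂ)))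

section Holomorphy

variable {EM : Type*} [NormedAddCommGroup EM] [NormedSpace ℂ EM] {HM : Type*} [TopologicalSpace HM]
  {I : ModelWithCorners ℂ EM HM} {M : Type*} [TopologicalSpace M] [ChartedSpace HM M]

theorem contMDiffAt_iff {f : M → Aff n} {x₀ : M} :
    ContMDiffAt I (affI n) ω f x₀ ↔
      ContMDiffAt I 𝓘(ℂ, (Fin n → ℂ) →L[ℂ] (Fin n → ℂ)) ω (fun x => (f x).lin.1) x₀ ∧
        ContMDiffAt I 𝓘(ℂ, Fin n → ℂ) ω (fun x => (f x).trans) x₀ := by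
  rw [← contMDiffAt_units_iff]
  exact contMDiffAt_prod_iff (I := I) (M' := ((Fin n → ℂ) →L[ℂ] (Fin n → ℂ))ˣ)
    (N' := Fin n → ℂ) f

/-- A map to the affine group is holomorphic iff it is so as a family of block matrices. -/
theorem contMDiffAt_iff_actL {f : M → Aff n} {x₀ : M} :
    ContMDiffAt I (affI n) ω f x₀ ↔
      ContMDiffAt I 𝓘(ℂ, ((Fin n → ℂ) × ℂ) →L[ℂ] (Fin n → ℂ) × ℂ) ω (fun x => (f x).actL) x₀ := by
  rw [contMDiffAt_iff]
  constructor
  · rintro ⟨h1, h2⟩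
    refine contMDiffAt_clm_of_apply fun v => ContMDiffAt.prodMk_space ?_ contMDiffAt_const
    exact (h1.clm_apply (contMDiffAt_const (c := v.1))).add
      ((contMDiffAt_const (I' := 𝓘(ℂ, ℂ)) (c := v.2)).smul h2)
  · intro h
    have hf : ∀ v, ContMDiffAt I 𝓘(ℂ, Fin n → ℂ) ω (fun x => ((f x).actL v).1) x₀ := fun v =>
      (ContinuousLinearMap.fst ℂ (Fin n → ℂ) ℂ).contMDiff.contMDiffAt.comp x₀
        (h.clm_apply contMDiffAt_const)
    refine ⟨contMDiffAt_clm_of_apply fun v => ?_, ?_⟩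
    -- The linear part is read off at (v, 0) and the translation part at (0, 1).
    · simpa [act] using hf (v, 0)
    · simpa [act] using hf (0, 1)

/-- In terms of block matrices, multiplication is composition of operators, which is bilinear. -/
theorem contMDiffAt_mul {f g : M → Aff n} {x₀ : M} (hf : ContMDiffAt I (affI n) ω f x₀)
    (hg : ContMDiffAt I (affI n) ω g x₀) : ContMDiffAt I (affI n) ω (fun x => f x * g x) x₀ := by
  rw [contMDiffAt_iff_actL] at hf hg ⊢
  simp_rw [actL_mul]
  exact hf.clm_comp hg

end Holomorphy

end Aff

end AffineBundle
-- Vector bundles glued from linear cocycles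
namespace AffineBundle

/-- A holomorphic cocycle of linear automorphisms of `F`, for an open cover of `X` indexed by the
points of `X`. -/
structure LinearCocycle (B : Type w) [NormedAddCommGroup B] [NormedSpace ℂ B]
    (X : Type u) [TopologicalSpace X] [ChartedSpace B X]
    (F : Type) [NormedAddCommGroup F] [NormedSpace ℂ F] where
  /-- the open sets of the cover -/
  U : X → Set X
  isOpen_U : ∀ i, IsOpen (U i)
  mem_U : ∀ x, x ∈ U x
  /-- the transition functions -/
  h : X → X → X → F →L[ℂ] F
  holomorphic : ∀ i j, ContMDiffOn 𝓘(ℂ, B) 𝓘(ℂ, F →L[ℂ] F) ω (h i j) (U i ∩ U j)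
  h_self : ∀ i, ∀ x ∈ U i, ∀ v, h i i x v = v
  h_comp : ∀ i j k, ∀ x ∈ U i, x ∈ U j → x ∈ U k → ∀ v, h i j x (h j k x v) = h i k x v

namespace LinearCocycle

variable {B : Type w} [NormedAddCommGroup B] [NormedSpace ℂ B]
  {X : Type u} [TopologicalSpace X] [ChartedSpace B X]
  {F : Type} [NormedAddCommGroup F] [NormedSpace ℂ F] (c : LinearCocycle B X F)

/-- Invertibility of the transition operators is not part of the structure; it is forced by the
cocycle identities. -/
theorem h_inv {i j x : X} (hi : x ∈ c.U i) (hj : x ∈ c.U j) (v : F) :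
    c.h i j x (c.h j i x v) = v := by
  rw [c.h_comp i j i x hi hj hi, c.h_self i x hi]

/-- The fibres of the bundle of a cocycle; the fibre at `x` is identified with `F` by the
trivialization of index `x`. -/
@[reducible] def Fibre (_ : LinearCocycle B X F) (_ : X) : Type u := ULift.{u} F

/-- The pretrivialization of index `i`. -/
noncomputable def pretriv (i : X) : Pretrivialization F (TotalSpace.proj (F := F) (E := c.Fibre)) where
  toFun p := (p.1, c.h i p.1 p.1 p.2.down)
  invFun q := ⟨q.1, ULift.up (c.h q.1 i q.1 q.2)⟩
  source := TotalSpace.proj ⁻¹' c.U i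
  target := c.U i ×ˢ Set.univ
  map_source' _ hp := ⟨hp, trivial⟩
  map_target' _ hq := hq.1
  left_inv' p hp := by
    refine TotalSpace.ext rfl (heq_of_eq ?_)
    exact ULift.ext _ _ (c.h_inv (c.mem_U p.1) hp p.2.down)
  right_inv' q hq := Prod.ext rfl (c.h_inv hq.1 (c.mem_U q.1) q.2)
  open_target := (c.isOpen_U i).prod isOpen_univ
  baseSet := c.U i
  open_baseSet := c.isOpen_U i
  source_eq := rfl
  target_eq := rfl
  proj_toFun _ _ := rfl

theorem pretriv_symm {i x : X} (hx : x ∈ c.U i) (v : F) :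
    (c.pretriv i).symm x v = ULift.up (c.h x i x v) := by
  have h := (c.pretriv i).mk_symm (show x ∈ (c.pretriv i).baseSet from hx) v
  exact eq_of_heq (TotalSpace.mk.inj h).2

/-- The vector prebundle of a cocycle. -/
noncomputable def prebundle : VectorPrebundle ℂ F c.Fibre where
  pretrivializationAtlas := Set.range c.pretriv
  pretrivialization_linear' := by
    rintro _ ⟨i, rfl⟩
    exact ⟨fun x hx => ⟨fun a b => map_add (c.h i x x) a.down b.down,
      fun r a => map_smul (c.h i x x) r a.down⟩⟩
  pretrivializationAt := c.pretriv
  mem_base_pretrivializationAt := c.mem_U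
  pretrivialization_mem_atlas x := ⟨x, rfl⟩
  exists_coordChange := by
    rintro _ ⟨i, rfl⟩ _ ⟨j, rfl⟩
    refine ⟨c.h j i, ((c.holomorphic j i).continuousOn.mono ?_), fun x hx v => ?_⟩
    · exact (Set.inter_comm _ _).le
    · rw [c.pretriv_symm hx.1]
      exact (c.h_comp j x i x hx.2 (c.mem_U x) hx.1 v).symm
  totalSpaceMk_isInducing x := by
    -- The trivialization of index x is the identity on the fibre at x itself, so the fibre topology
    -- is that of F.
    have h1 : (c.pretriv x ∘ TotalSpace.mk x) = fun v : ULift.{u} F => (x, v.down) := by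
      funext v
      exact Prod.ext rfl (c.h_self x x (c.mem_U x) v.down)
    change Topology.IsInducing (c.pretriv x ∘ TotalSpace.mk x)
    rw [h1]
    exact (Topology.isInducing_const_prod.2 Topology.IsInducing.id).comp
      Homeomorph.ulift.isInducing

instance : c.prebundle.IsContMDiff 𝓘(ℂ, B) ω where
  exists_contMDiffCoordChange := by
    rintro _ ⟨i, rfl⟩ _ ⟨j, rfl⟩
    refine ⟨c.h j i, ((c.holomorphic j i).mono ?_), fun x hx v => ?_⟩
    · exact (Set.inter_comm _ _).le
    · rw [c.pretriv_symm hx.1]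
      exact (c.h_comp j x i x hx.2 (c.mem_U x) hx.1 v).symm

/-- The holomorphic vector bundle of a cocycle. -/
noncomputable def bundle : HolVB.{u, u} B X F :=
  letI := c.prebundle.totalSpaceTopology
  letI := c.prebundle.toFiberBundle
  haveI := c.prebundle.toVectorBundle
  haveI := c.prebundle.contMDiffVectorBundle (n := ω) 𝓘(ℂ, B)
  { E := c.Fibre }

/-- The trivialization of index `i`. -/
noncomputable def triv (i : X) : Trivialization F (TotalSpace.proj (F := F) (E := c.bundle.E)) :=
  c.prebundle.trivializationOfMemPretrivializationAtlas ⟨i, rfl⟩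

instance (i : X) : MemTrivializationAtlas (c.triv i) := ⟨⟨_, ⟨i, rfl⟩, rfl⟩⟩

/-- The vector stored over a y is expressed in the coordinates of index a y, which need not vary
holomorphically with y. Holomorphy is meaningful only after conversion to a fixed index i. -/
theorem contMDiffAt_total_iff {EM : Type*} [NormedAddCommGroup EM] [NormedSpace ℂ EM]
    {HM : Type*} [TopologicalSpace HM] {I : ModelWithCorners ℂ EM HM} {M : Type*}
    [TopologicalSpace M] [ChartedSpace HM M] {a : M → X} {v : M → F} {m : M} (i : X)
    (hi : a m ∈ c.U i) :
    ContMDiffAt I (𝓘(ℂ, B).prod 𝓘(ℂ, F)) ω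
        (fun y => (⟨a y, (ULift.up (v y) : c.Fibre (a y))⟩ : c.bundle.Total)) m ↔
      ContMDiffAt I 𝓘(ℂ, B) ω a m ∧ ContMDiffAt I 𝓘(ℂ, F) ω (fun y => c.h i (a y) (a y) (v y)) m :=
  Trivialization.contMDiffAt_iff (e := c.triv i) ((Trivialization.mem_source _).2 hi)

end LinearCocycle

end AffineBundle
-- Manifolds whose charts take values in a manifold
namespace AffineBundle

section TwoStepCharts

variable {E : Type*} [NormedAddCommGroup E] [NormedSpace ℂ E] {H₁ : Type*} [TopologicalSpace H₁]
  (I : ModelWithCorners ℂ E H₁) {H₂ : Type*} [TopologicalSpace H₂] [ChartedSpace H₁ H₂]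
  {H₃ : Type*} [TopologicalSpace H₃] [ChartedSpace H₂ H₃]

/-- The pregroupoid of holomorphic maps between open subsets of a manifold. -/
def contMDiffPregroupoid (H₂ : Type*) [TopologicalSpace H₂] [ChartedSpace H₁ H₂] :
    Pregroupoid H₂ where
  property f s := ContMDiffOn I I ω f s
  comp hf hg _ _ _ := hg.comp (hf.mono Set.inter_subset_left) fun _ hx => hx.2
  id_mem := contMDiffOn_id
  locality _ h := contMDiffOn_of_locally_contMDiffOn fun x hx => by
    obtain ⟨v, hv, hxv, h⟩ := h x hx
    exact ⟨v, hv, hxv, h⟩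
  congr _ hfg hf := hf.congr hfg

variable (h : ∀ e ∈ atlas H₂ H₃, ∀ e' ∈ atlas H₂ H₃,
  ContMDiffOn I I ω (e.symm ≫ₕ e') (e.symm ≫ₕ e').source)

include h in
/-- A space with charts in a manifold and holomorphic transition maps is a manifold. -/
theorem isManifold_comp [IsManifold I ω H₂] :
    @IsManifold ℂ _ E _ _ H₁ _ I ω H₃ _ (ChartedSpace.comp H₁ H₂ H₃) := by
  let := ChartedSpace.comp H₁ H₂ H₃
  have : HasGroupoid H₃ (contMDiffPregroupoid I H₂).groupoid :=
    hasGroupoid_of_pregroupoid _ fun {e e'} he he' => h e he e' he'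
  -- What remains is that biholomorphic maps between open subsets of H₂ are local structomorphisms,
  -- which for a manifold H₂ means holomorphic in both directions.
  refine { StructureGroupoid.HasGroupoid.comp (contMDiffPregroupoid I H₂).groupoid ?_ with }
  intro e he
  rw [isLocalStructomorphOn_contDiffGroupoid_iff]
  exact mem_groupoid_of_pregroupoid.1 he

/-- Near a point e is f⁻¹ ∘ (f ∘ e) for a chart f of H₂, where f ∘ e is itself a chart of the
composed structure; the inverse of e is treated in the same way. -/
theorem contMDiffOn_chart_comp [IsManifold I ω H₂]
    (hm : @IsManifold ℂ _ E _ _ H₁ _ I ω H₃ _ (ChartedSpace.comp H₁ H₂ H₃))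
    {e : OpenPartialHomeomorph H₃ H₂} (he : e ∈ atlas H₂ H₃) :
    letI := ChartedSpace.comp H₁ H₂ H₃
    ContMDiffOn I I ω e e.source ∧ ContMDiffOn I I ω e.symm e.target := by
  let := ChartedSpace.comp H₁ H₂ H₃
  have hf : ∀ y : H₂, e ≫ₕ chartAt H₁ y ∈ IsManifold.maximalAtlas I ω H₃ := fun y =>
    IsManifold.subset_maximalAtlas ⟨e, he, chartAt H₁ y, chart_mem_atlas H₁ y, rfl⟩
  have hc : ∀ y : H₂, chartAt H₁ y ∈ IsManifold.maximalAtlas I ω H₂ := fun y =>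
    IsManifold.subset_maximalAtlas (chart_mem_atlas H₁ y)
  constructor
  · intro p hp
    refine ContMDiffAt.contMDiffWithinAt ?_
    set f := chartAt H₁ (e p)
    have hpf : p ∈ (e ≫ₕ f).source := by simp [f, hp]
    have h1 := (contMDiffOn_of_mem_maximalAtlas (hf (e p))).contMDiffAt
      ((e ≫ₕ f).open_source.mem_nhds hpf)
    have h2 := (contMDiffOn_symm_of_mem_maximalAtlas (hc (e p))).contMDiffAt
      (f.open_target.mem_nhds (f.map_source (mem_chart_source H₁ (e p))))
    refine (ContMDiffAt.comp (g := f.symm) p h2 h1).congr_of_eventuallyEq ?_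
    filter_upwards [(e ≫ₕ f).open_source.mem_nhds hpf] with q hq
    rw [OpenPartialHomeomorph.trans_source] at hq
    exact (f.left_inv hq.2).symm
  · intro y hy
    refine ContMDiffAt.contMDiffWithinAt ?_
    set f := chartAt H₁ y
    have hyf : f y ∈ (e ≫ₕ f).target := by
      rw [OpenPartialHomeomorph.trans_target]
      refine ⟨f.map_source (mem_chart_source H₁ y), ?_⟩
      simp [f, hy]
    have h1 := (contMDiffOn_symm_of_mem_maximalAtlas (hf y)).contMDiffAt
      ((e ≫ₕ f).open_target.mem_nhds hyf)
    have h2 := (contMDiffOn_of_mem_maximalAtlas (hc y)).contMDiffAt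
      (f.open_source.mem_nhds (mem_chart_source H₁ y))
    refine (ContMDiffAt.comp (g := (e ≫ₕ f).symm) y h1 h2).congr_of_eventuallyEq ?_
    filter_upwards [f.open_source.mem_nhds (mem_chart_source H₁ y)] with q hq
    exact congrArg e.symm (f.left_inv hq).symm

end TwoStepCharts

/-! ### Principal bundles glued from affine cocycles -/

/-- A holomorphic cocycle with values in the affine group, for an open cover of `X` indexed by the
points of `X`. -/
structure AffCocycle (B : Type w) [NormedAddCommGroup B] [NormedSpace ℂ B]
    (X : Type u) [TopologicalSpace X] [ChartedSpace B X] (n : ℕ) where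
  /-- the open sets of the cover -/
  U : X → Set X
  isOpen_U : ∀ i, IsOpen (U i)
  mem_U : ∀ x, x ∈ U x
  /-- the transition functions -/
  g : X → X → X → Aff n
  holomorphic : ∀ i j, ∀ x ∈ U i, x ∈ U j → ContMDiffAt 𝓘(ℂ, B) (affI n) ω (g i j) x
  g_self : ∀ i, ∀ x ∈ U i, g i i x = 1
  g_comp : ∀ i j k, ∀ x ∈ U i, x ∈ U j → x ∈ U k → g i j x * g j k x = g i k x

namespace AffCocycle

variable {B : Type w} [NormedAddCommGroup B] [NormedSpace ℂ B]
  {X : Type u} [TopologicalSpace X] [ChartedSpace B X] {n : ℕ} (c : AffCocycle B X n)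

theorem g_inv {i j x : X} (hi : x ∈ c.U i) (hj : x ∈ c.U j) : c.g i j x * c.g j i x = 1 := by
  rw [c.g_comp i j i x hi hj hi, c.g_self i x hi]

/-- The cocycle of the associated bundle with fibre `ℂⁿ × ℂ`. -/
noncomputable def toLinear : LinearCocycle B X ((Fin n → ℂ) × ℂ) where
  U := c.U
  isOpen_U := c.isOpen_U
  mem_U := c.mem_U
  h i j x := (c.g i j x).actL
  holomorphic i j x hx :=
    (Aff.contMDiffAt_iff_actL.1 (c.holomorphic i j x hx.1 hx.2)).contMDiffWithinAt
  h_self i x hx v := by rw [c.g_self i x hx, Aff.actL_one]; rfl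
  h_comp i j k x hi hj hk v := by rw [← c.g_comp i j k x hi hj hk, Aff.actL_mul]; rfl

/-- The cocycle of linear parts. -/
noncomputable def linPart : LinearCocycle B X (Fin n → ℂ) where
  U := c.U
  isOpen_U := c.isOpen_U
  mem_U := c.mem_U
  h i j x := (c.g i j x).lin.1
  holomorphic i j x hx :=
    (Aff.contMDiffAt_iff.1 (c.holomorphic i j x hx.1 hx.2)).1.contMDiffWithinAt
  h_self i x hx v := by rw [c.g_self i x hx]; rfl
  h_comp i j k x hi hj hk v := by rw [← c.g_comp i j k x hi hj hk]; rfl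

/-- The total space of the principal bundle of a cocycle; the fibre at `x` is identified with the
affine group by the trivialization of index `x`. -/
def Total (_ : AffCocycle B X n) : Type u := X × Aff n

/-- The trivialization of index `i`. -/
noncomputable def chart (i : X) : PartialEquiv c.Total (X × Aff n) where
  toFun p := (p.1, c.g i p.1 p.1 * p.2)
  invFun q := (q.1, c.g q.1 i q.1 * q.2)
  source := {p | p.1 ∈ c.U i}
  target := c.U i ×ˢ Set.univ
  map_source' _ hp := ⟨hp, trivial⟩
  map_target' _ hq := hq.1
  left_inv' p hp := by
    refine Prod.ext rfl ?_
    change c.g p.1 i p.1 * (c.g i p.1 p.1 * p.2) = p.2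
    rw [← mul_assoc, c.g_inv (c.mem_U p.1) hp, one_mul]
  right_inv' q hq := by
    refine Prod.ext rfl ?_
    change c.g i q.1 q.1 * (c.g q.1 i q.1 * q.2) = q.2
    rw [← mul_assoc, c.g_inv hq.1 (c.mem_U q.1), one_mul]

theorem chart_symm_trans_source (i j : X) :
    ((c.chart i).symm.trans (c.chart j)).source = (c.U i ∩ c.U j) ×ˢ Set.univ := by
  ext ⟨x, a⟩
  simp only [PartialEquiv.trans_source, Set.mem_prod, Set.mem_univ, and_true]
  change (x ∈ c.U i ∧ True) ∧ x ∈ c.U j ↔ x ∈ c.U i ∧ x ∈ c.U j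
  simp

/-- The irregular dependence on the index x cancels, since g_jx g_xi = g_ji: the transition map is
left multiplication by the holomorphic g_ji(x). -/
theorem contMDiffOn_chart_symm_trans (i j : X) :
    ContMDiffOn (𝓘(ℂ, B).prod (affI n)) (𝓘(ℂ, B).prod (affI n)) ω
      ((c.chart i).symm.trans (c.chart j)) ((c.chart i).symm.trans (c.chart j)).source := by
  rw [chart_symm_trans_source]
  have h1 : ContMDiffOn (𝓘(ℂ, B).prod (affI n)) (𝓘(ℂ, B).prod (affI n)) ω
      (fun q : X × Aff n => (q.1, c.g j i q.1 * q.2)) ((c.U i ∩ c.U j) ×ˢ Set.univ) := by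
    intro q hq
    refine ContMDiffAt.contMDiffWithinAt (contMDiffAt_fst.prodMk (Aff.contMDiffAt_mul ?_ contMDiffAt_snd))
    exact (c.holomorphic j i q.1 hq.1.2 hq.1.1).comp q contMDiffAt_fst
  refine h1.congr fun q hq => Prod.ext rfl ?_
  change c.g j q.1 q.1 * (c.g q.1 i q.1 * q.2) = c.g j i q.1 * q.2
  rw [← mul_assoc, c.g_comp j q.1 i q.1 hq.1.2 (c.mem_U _) hq.1.1]

/-- The manifold structure of the principal bundle of a cocycle. -/
noncomputable def core : ChartedSpaceCore (X × Aff n) c.Total where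
  atlas := Set.range c.chart
  chartAt p := c.chart p.1
  mem_chart_source p := c.mem_U p.1
  chart_mem_atlas p := ⟨p.1, rfl⟩
  open_source := by
    rintro _ _ ⟨i, rfl⟩ ⟨j, rfl⟩
    rw [chart_symm_trans_source]
    exact ((c.isOpen_U i).inter (c.isOpen_U j)).prod isOpen_univ
  continuousOn_toFun := by
    rintro _ _ ⟨i, rfl⟩ ⟨j, rfl⟩
    exact (c.contMDiffOn_chart_symm_trans i j).continuousOn

noncomputable instance : TopologicalSpace c.Total := c.core.toTopologicalSpace

noncomputable instance : ChartedSpace (X × Aff n) c.Total := c.core.toChartedSpace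

noncomputable instance : ChartedSpace (ModelProd B (AffModel n)) c.Total :=
  ChartedSpace.comp (ModelProd B (AffModel n)) (X × Aff n) c.Total

/-- The trivialization of index `i` as a partial homeomorphism. -/
noncomputable def chartHomeo (i : X) : OpenPartialHomeomorph c.Total (X × Aff n) :=
  c.core.openPartialHomeomorph (c.chart i) ⟨i, rfl⟩

theorem mem_atlas_iff (e : OpenPartialHomeomorph c.Total (X × Aff n)) :
    e ∈ atlas (X × Aff n) c.Total ↔ ∃ i, e = c.chartHomeo i := by
  change e ∈ (⋃ (e : PartialEquiv _ _) (he : e ∈ c.core.atlas),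
    {c.core.openPartialHomeomorph e he} : Set _) ↔ _
  simp only [Set.mem_iUnion, Set.mem_singleton_iff]
  constructor
  · rintro ⟨_, ⟨i, rfl⟩, h⟩
    exact ⟨i, h⟩
  · rintro ⟨i, h⟩
    exact ⟨_, ⟨i, rfl⟩, h⟩

instance [IsManifold 𝓘(ℂ, B) ω X] : IsManifold (𝓘(ℂ, B).prod (affI n)) ω c.Total := by
  refine isManifold_comp (𝓘(ℂ, B).prod (affI n)) (H₂ := X × Aff n) fun e he e' he' => ?_
  obtain ⟨i, rfl⟩ := (c.mem_atlas_iff e).1 he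
  obtain ⟨j, rfl⟩ := (c.mem_atlas_iff e').1 he'
  exact c.contMDiffOn_chart_symm_trans i j

open MulOpposite in
-- Trivializations differ by left multiplications, so right multiplication of the stored group
-- elements is right translation in all of them.
noncomputable instance : MulAction (Aff n)ᵐᵒᵖ c.Total where
  smul g p := (p.1, p.2 * g.unop)
  one_smul p := Prod.ext rfl (mul_one p.2)
  mul_smul g h p := Prod.ext rfl (mul_assoc p.2 h.unop g.unop).symm

variable [IsManifold 𝓘(ℂ, B) ω X]

theorem contMDiffOn_chartHomeo (i : X) :
    ContMDiffOn (𝓘(ℂ, B).prod (affI n)) (𝓘(ℂ, B).prod (affI n)) ω (c.chartHomeo i)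
        (c.chartHomeo i).source ∧
      ContMDiffOn (𝓘(ℂ, B).prod (affI n)) (𝓘(ℂ, B).prod (affI n)) ω (c.chartHomeo i).symm
        (c.chartHomeo i).target :=
  contMDiffOn_chart_comp _ inferInstance ((c.mem_atlas_iff _).2 ⟨i, rfl⟩)

/-- The holomorphic principal bundle of a cocycle. -/
noncomputable def principal : PrincipalAff B X n where
  P := c.Total
  proj p := p.1
  proj_smul _ _ := rfl
  locallyTrivial x := ⟨c.U x, c.isOpen_U x, c.mem_U x, c.chartHomeo x, rfl, rfl,
    (c.contMDiffOn_chartHomeo x).1, (c.contMDiffOn_chartHomeo x).2, fun p _ =>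
      ⟨rfl, fun g => Prod.ext rfl (mul_assoc _ p.2 g).symm⟩⟩

end AffCocycle

end AffineBundle
-- Holomorphic frames and coordinates
namespace AffineBundle

variable {B : Type w} [NormedAddCommGroup B] [NormedSpace ℂ B]
  {X : Type u} [TopologicalSpace X] [ChartedSpace B X]

namespace HolVB

variable {F : Type} [NormedAddCommGroup F] [NormedSpace ℂ F]
  {F' : Type} [NormedAddCommGroup F'] [NormedSpace ℂ F']

section Coordinates

variable {EM : Type*} [NormedAddCommGroup EM] [NormedSpace ℂ EM]
  {HM : Type*} [TopologicalSpace HM] {I : ModelWithCorners ℂ EM HM} {M : Type*}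
  [TopologicalSpace M] [ChartedSpace HM M]

/-- Coordinates are read by `linearMapAt`, which is linear at every point (zero off the base set),
so sums and scalars pass through without restriction to a neighbourhood. -/
theorem contMDiffAt_total_iff (V : HolVB.{u, v} B X F) {x₀ : X} {a : M → X} {s : ∀ y, V.E (a y)}
    {m : M} (hm : a m ∈ (trivializationAt F V.E x₀).baseSet) :
    ContMDiffAt I (𝓘(ℂ, B).prod 𝓘(ℂ, F)) ω (fun y => (⟨a y, s y⟩ : V.Total)) m ↔
      ContMDiffAt I 𝓘(ℂ, B) ω a m ∧ ContMDiffAt I 𝓘(ℂ, F) ω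
        (fun y => (trivializationAt F V.E x₀).linearMapAt ℂ (a y) (s y)) m := by
  refine (Trivialization.contMDiffAt_iff (e := trivializationAt F V.E x₀)
    ((Trivialization.mem_source _).2 hm)).trans (and_congr_right fun ha => ?_)
  refine Filter.EventuallyEq.contMDiffAt_iff ?_
  filter_upwards [ha.continuousAt.preimage_mem_nhds
    ((trivializationAt F V.E x₀).open_baseSet.mem_nhds hm)] with y hy
  rw [(trivializationAt F V.E x₀).coe_linearMapAt_of_mem (R := ℂ) hy]

theorem contMDiffAt_sum (V : HolVB.{u, v} B X F) {ι : Type*} (t : Finset ι) {a : M → X}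
    {s : ι → ∀ y, V.E (a y)} {m : M} (ha : ContMDiffAt I 𝓘(ℂ, B) ω a m)
    (hs : ∀ i ∈ t, ContMDiffAt I (𝓘(ℂ, B).prod 𝓘(ℂ, F)) ω (fun y => (⟨a y, s i y⟩ : V.Total)) m) :
    ContMDiffAt I (𝓘(ℂ, B).prod 𝓘(ℂ, F)) ω (fun y => (⟨a y, ∑ i ∈ t, s i y⟩ : V.Total)) m := by
  have hm := mem_baseSet_trivializationAt F V.E (a m)
  refine (V.contMDiffAt_total_iff hm).2 ⟨ha, ?_⟩
  simp_rw [map_sum]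
  exact contMDiffAt_finsetSum fun i hi => ((V.contMDiffAt_total_iff hm).1 (hs i hi)).2

theorem contMDiffAt_add (V : HolVB.{u, v} B X F) {a : M → X} {s t : ∀ y, V.E (a y)} {m : M}
    (hs : ContMDiffAt I (𝓘(ℂ, B).prod 𝓘(ℂ, F)) ω (fun y => (⟨a y, s y⟩ : V.Total)) m)
    (ht : ContMDiffAt I (𝓘(ℂ, B).prod 𝓘(ℂ, F)) ω (fun y => (⟨a y, t y⟩ : V.Total)) m) :
    ContMDiffAt I (𝓘(ℂ, B).prod 𝓘(ℂ, F)) ω (fun y => (⟨a y, s y + t y⟩ : V.Total)) m := by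
  have hm := mem_baseSet_trivializationAt F V.E (a m)
  obtain ⟨ha, h⟩ := (V.contMDiffAt_total_iff hm).1 hs
  refine (V.contMDiffAt_total_iff hm).2 ⟨ha, ?_⟩
  simp_rw [map_add]
  exact h.add ((V.contMDiffAt_total_iff hm).1 ht).2

theorem contMDiffAt_smul (V : HolVB.{u, v} B X F) {a : M → X}
    {r : M → ℂ} {s : ∀ y, V.E (a y)} {m : M} (hr : ContMDiffAt I 𝓘(ℂ, ℂ) ω r m)
    (hs : ContMDiffAt I (𝓘(ℂ, B).prod 𝓘(ℂ, F)) ω (fun y => (⟨a y, s y⟩ : V.Total)) m) :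
    ContMDiffAt I (𝓘(ℂ, B).prod 𝓘(ℂ, F)) ω (fun y => (⟨a y, r y • s y⟩ : V.Total)) m := by
  have hm := mem_baseSet_trivializationAt F V.E (a m)
  obtain ⟨ha, h⟩ := (V.contMDiffAt_total_iff hm).1 hs
  refine (V.contMDiffAt_total_iff hm).2 ⟨ha, ?_⟩
  simp_rw [map_smul]
  exact hr.smul h

variable [FiniteDimensional ℂ F]

/-- The coordinates of a holomorphic section with respect to a holomorphic frame are
holomorphic. -/
theorem contMDiffAt_coord (V : HolVB.{u, v} B X F) {a : M → X} {s : ∀ y, V.E (a y)}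
    {b : ∀ y, F →ₗ[ℂ] V.E (a y)} {c : M → F} {m : M} (hb : Function.Injective (b m))
    (hbh : ∀ v, ContMDiffAt I (𝓘(ℂ, B).prod 𝓘(ℂ, F)) ω (fun y => (⟨a y, b y v⟩ : V.Total)) m)
    (hs : ContMDiffAt I (𝓘(ℂ, B).prod 𝓘(ℂ, F)) ω (fun y => (⟨a y, s y⟩ : V.Total)) m)
    (hc : ∀ᶠ y in nhds m, b y (c y) = s y) : ContMDiffAt I 𝓘(ℂ, F) ω c m := by
  set e := trivializationAt F V.E (a m)
  have hm : a m ∈ e.baseSet := mem_baseSet_trivializationAt F V.E (a m)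
  -- The matrix of the frame in a trivialization. It is invertible at m, hence nearby, and c is its
  -- inverse applied to the coordinates of s.
  let L : M → F →L[ℂ] F := fun y =>
    LinearMap.toContinuousLinearMap ((e.linearMapAt ℂ (a y)).comp (b y))
  have hL : ContMDiffAt I 𝓘(ℂ, F →L[ℂ] F) ω L m :=
    contMDiffAt_clm_of_apply fun v => ((V.contMDiffAt_total_iff hm).1 (hbh v)).2
  have hinj : Function.Injective ((e.linearMapAt ℂ (a m)).comp (b m)) :=
    (Function.LeftInverse.injective (fun y => e.symmₗ_linearMapAt hm y)).comp hb
  have hu : IsUnit (L m) := by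
    let E := LinearEquiv.ofBijective _ ⟨hinj, LinearMap.injective_iff_surjective.1 hinj⟩
    exact ⟨ContinuousLinearEquiv.toUnit E.toContinuousLinearEquiv, rfl⟩
  have hunit : ∀ᶠ y in nhds m, IsUnit (L y) :=
    hL.continuousAt (Units.isOpen.mem_nhds hu)
  refine ((contMDiffAt_ringInverse hL hu).clm_apply
    ((V.contMDiffAt_total_iff hm).1 hs).2).congr_of_eventuallyEq ?_
  filter_upwards [hunit, hc] with y hy hcy
  rw [← hcy]
  change c y = (Ring.inverse (L y) * L y) (c y)
  rw [Ring.inverse_mul_cancel _ hy]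
  rfl

/-- A holomorphic combination of a finite family of holomorphic sections is holomorphic. -/
theorem contMDiffAt_frame_apply (V : HolVB.{u, v} B X F') {a : M → X}
    {b : ∀ y, F →ₗ[ℂ] V.E (a y)} {c : M → F} {m : M} (ha : ContMDiffAt I 𝓘(ℂ, B) ω a m)
    (hb : ∀ v, ContMDiffAt I (𝓘(ℂ, B).prod 𝓘(ℂ, F')) ω (fun y => (⟨a y, b y v⟩ : V.Total)) m)
    (hc : ContMDiffAt I 𝓘(ℂ, F) ω c m) :
    ContMDiffAt I (𝓘(ℂ, B).prod 𝓘(ℂ, F')) ω (fun y => (⟨a y, b y (c y)⟩ : V.Total)) m := by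
  let β := Module.finBasis ℂ F
  have h := V.contMDiffAt_sum Finset.univ (s := fun i y => β.repr (c y) i • b y (β i)) ha
    fun i _ => V.contMDiffAt_smul
      ((LinearMap.toContinuousLinearMap (β.coord i)).contMDiff.contMDiffAt.comp m hc) (hb (β i))
  refine h.congr_of_eventuallyEq (Filter.Eventually.of_forall fun y => ?_)
  refine congrArg (TotalSpace.mk (a y)) ?_
  conv_lhs => rw [← β.sum_repr (c y), map_sum]
  simp_rw [map_smul]

end Coordinates

/-- A fibrewise linear map is holomorphic if it maps local holomorphic frames to holomorphic
sections. -/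
theorem contMDiff_of_frames [FiniteDimensional ℂ F] (V : HolVB.{u, v} B X F)
    (V' : HolVB.{u, v'} B X F') (f : ∀ x, V.E x →ₗ[ℂ] V'.E x)
    (h : ∀ x₀, ∃ b : ∀ x, F →ₗ[ℂ] V.E x, (∀ᶠ x in nhds x₀, Function.Bijective (b x)) ∧
      (∀ v, ContMDiffAt 𝓘(ℂ, B) (𝓘(ℂ, B).prod 𝓘(ℂ, F)) ω (fun x => (⟨x, b x v⟩ : V.Total)) x₀) ∧
      ∀ v, ContMDiffAt 𝓘(ℂ, B) (𝓘(ℂ, B).prod 𝓘(ℂ, F')) ω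
        (fun x => (⟨x, f x (b x v)⟩ : V'.Total)) x₀) :
    ContMDiff (𝓘(ℂ, B).prod 𝓘(ℂ, F)) (𝓘(ℂ, B).prod 𝓘(ℂ, F')) ω
      (fun z : V.Total => (⟨z.proj, f z.proj z.snd⟩ : V'.Total)) := by
  intro z₀
  obtain ⟨b, hb, hbh, hfb⟩ := h z₀.proj
  have hproj : ContMDiffAt (𝓘(ℂ, B).prod 𝓘(ℂ, F)) 𝓘(ℂ, B) ω (fun z : V.Total => z.proj) z₀ :=
    (Bundle.contMDiff_proj V.E).contMDiffAt
  have hb' := hproj.continuousAt.eventually hb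
  -- Coordinates in the frame b; the value of `invFun` matters only near z₀, where b is bijective.
  let c : V.Total → F := fun z => Function.invFun (b z.proj) z.snd
  have hc : ∀ᶠ z : V.Total in nhds z₀, b z.proj (c z) = z.snd := by
    filter_upwards [hb'] with z hz
    exact Function.invFun_eq (hz.2 z.snd)
  have hch : ContMDiffAt (𝓘(ℂ, B).prod 𝓘(ℂ, F)) 𝓘(ℂ, F) ω c z₀ :=
    V.contMDiffAt_coord (a := fun z : V.Total => z.proj) (s := fun z => z.snd)
      (b := fun z => b z.proj) hb.self_of_nhds.1
      (fun v => (hbh v).comp z₀ hproj) contMDiffAt_id hc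
  refine (V'.contMDiffAt_frame_apply (a := fun z : V.Total => z.proj)
    (b := fun z => (f z.proj).comp (b z.proj)) hproj (fun v => (hfb v).comp z₀ hproj)
    hch).congr_of_eventuallyEq ?_
  filter_upwards [hc] with z hz
  change _ = (⟨z.proj, f z.proj (b z.proj (c z))⟩ : V'.Total)
  rw [hz]

/-- Around each point there is a holomorphic frame, given by a trivialization. -/
theorem exists_frame (V : HolVB.{u, v} B X F) (x₀ : X) : ∃ (U : Opens X) (_ : x₀ ∈ U)
    (b : ∀ x, F →ₗ[ℂ] V.E x), (∀ x ∈ U, Function.Bijective (b x)) ∧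
      ∀ v, ∀ x ∈ U, ContMDiffAt 𝓘(ℂ, B) (𝓘(ℂ, B).prod 𝓘(ℂ, F)) ω
        (fun x => (⟨x, b x v⟩ : V.Total)) x := by
  set e := trivializationAt F V.E x₀
  refine ⟨⟨e.baseSet, e.open_baseSet⟩, mem_baseSet_trivializationAt F V.E x₀,
    fun x => e.symmₗ ℂ x, fun x hx => ⟨?_, ?_⟩, fun v x hx => ?_⟩
  · exact Function.LeftInverse.injective (fun y => e.linearMapAt_symmₗ hx y)
  · exact Function.RightInverse.surjective (fun y => e.symmₗ_linearMapAt hx y)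
  · exact V.contMDiffOn_localFrame x₀ contMDiffAt_id contMDiffAt_const hx

/-- A fibrewise linear map is a morphism if its composition with a fibrewise injective morphism
is. -/
theorem contMDiff_of_comp_injective [FiniteDimensional ℂ F] [FiniteDimensional ℂ F']
    {F'' : Type} [NormedAddCommGroup F''] [NormedSpace ℂ F''] [FiniteDimensional ℂ F'']
    {V : HolVB.{u, v} B X F} {V' : HolVB.{u, v} B X F'} {W : HolVB.{u, v} B X F''}
    (f : ∀ x, V.E x →ₗ[ℂ] V'.E x) (i : Hom V' W) (hi : ∀ x, Function.Injective (i.lin x))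
    (k : Hom V W) (hk : ∀ x v, i.lin x (f x v) = k.lin x v) :
    ContMDiff (𝓘(ℂ, B).prod 𝓘(ℂ, F)) (𝓘(ℂ, B).prod 𝓘(ℂ, F')) ω
      (fun z : V.Total => (⟨z.proj, f z.proj z.snd⟩ : V'.Total)) := by
  refine contMDiff_of_frames V V' f fun x₀ => ?_
  obtain ⟨U, hx₀, b, hb, hbh⟩ := V.exists_frame x₀
  refine ⟨b, Filter.eventually_of_mem (U.2.mem_nhds hx₀) hb, fun v => hbh v x₀ hx₀, fun v => ?_⟩
  have h : V'.IsHolSection U (fun x => f x (b x v)) := by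
    refine i.isHolSection_of_injective hi ?_
    simp_rw [hk]
    exact fun x => k.holomorphic'.contMDiffAt.comp x
      (contMDiffAt_subtype_iff.2 (hbh v x.1 x.2))
  exact (contMDiffAt_subtype_iff (U := U) (x := ⟨x₀, hx₀⟩)
    (f := fun x => (⟨x, f x (b x v)⟩ : V'.Total))).1 (h ⟨x₀, hx₀⟩)

end HolVB

end AffineBundle
-- Local sections of principal bundles
namespace AffineBundle

open MulOpposite

variable {B : Type w} [NormedAddCommGroup B] [NormedSpace ℂ B]
  {X : Type u} [TopologicalSpace X] [ChartedSpace B X] {n : ℕ}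

/-- A local holomorphic section `σ` of a principal bundle around `x₀`, together with the fibre
coordinate `k` that it defines. -/
structure PrincipalAff.LocalSection (Q : PrincipalAff B X n) (x₀ : X) where
  /-- the domain of the section -/
  U : Set X
  isOpen_U : IsOpen U
  mem_U : x₀ ∈ U
  /-- the section -/
  σ : X → Q.P
  /-- the fibre coordinate -/
  k : Q.P → Aff n
  proj_σ : ∀ x ∈ U, Q.proj (σ x) = x
  k_σ : ∀ x ∈ U, k (σ x) = 1
  k_smul : ∀ g q, Q.proj q ∈ U → k (op g • q) = k q * g
  smul_σ : ∀ q, Q.proj q ∈ U → op (k q) • σ (Q.proj q) = q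
  holomorphic_k : ∀ q, Q.proj q ∈ U → ContMDiffAt (𝓘(ℂ, B).prod (affI n)) (affI n) ω k q
  holomorphic_proj : ∀ q, Q.proj q ∈ U →
    ContMDiffAt (𝓘(ℂ, B).prod (affI n)) 𝓘(ℂ, B) ω Q.proj q
  holomorphic_smul : ∀ x ∈ U, ∀ g, ContMDiffAt (𝓘(ℂ, B).prod (affI n)) (𝓘(ℂ, B).prod (affI n)) ω
    (fun z : X × Aff n => op z.2 • σ z.1) (x, g)

/-- A local trivialization e gives σ x = e⁻¹(x, 1) and k = the group component of e. Equivariance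
and injectivity of e give e⁻¹(x, a) = σ(x)·a, and the identities and the holomorphy follow. -/
theorem PrincipalAff.nonempty_localSection (Q : PrincipalAff B X n) (x₀ : X) :
    Nonempty (Q.LocalSection x₀) := by
  obtain ⟨U, hU, hx, e, hs, ht, he, hes, h⟩ := Q.locallyTrivial x₀
  have memt : ∀ x ∈ U, ∀ a : Aff n, (x, a) ∈ e.target := fun x hx a => by
    rw [ht]; exact ⟨hx, trivial⟩
  have mems : ∀ q, Q.proj q ∈ U → q ∈ e.source := fun q hq => by rw [hs]; exact hq
  have hproj : ∀ x ∈ U, ∀ a : Aff n, Q.proj (e.symm (x, a)) = x := fun x hx a => by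
    rw [← (h _ (e.map_target (memt x hx a))).1, e.right_inv (memt x hx a)]
  have hsmul : ∀ q, Q.proj q ∈ U → ∀ g, e (op g • q) = (Q.proj q, (e q).2 * g) := fun q hq g => by
    rw [(h q (mems q hq)).2 g, (h q (mems q hq)).1]
  have hsymm : ∀ x ∈ U, ∀ a : Aff n, op a • e.symm (x, 1) = e.symm (x, a) := fun x hx a => by
    have hp := hproj x hx 1
    refine e.injOn (mems _ ?_) (mems _ ?_) ?_
    · rw [Q.proj_smul, hp]; exact hx
    · rw [hproj x hx]; exact hx
    · rw [hsmul _ (by rw [hp]; exact hx), e.right_inv (memt x hx a), e.right_inv (memt x hx 1), hp,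
        one_mul]
  have hat : ∀ q, Q.proj q ∈ U →
      ContMDiffAt (𝓘(ℂ, B).prod (affI n)) (𝓘(ℂ, B).prod (affI n)) ω e q := fun q hq =>
    he.contMDiffAt (e.open_source.mem_nhds (mems q hq))
  exact ⟨{
    U := U
    isOpen_U := hU
    mem_U := hx
    σ := fun x => e.symm (x, 1)
    k := fun q => (e q).2
    proj_σ := fun x hx => hproj x hx 1
    k_σ := fun x hx => by rw [e.right_inv (memt x hx 1)]
    k_smul := fun g q hq => by rw [hsmul q hq]
    smul_σ := fun q hq => by
      rw [hsymm _ hq, ← (h q (mems q hq)).1]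
      exact e.left_inv (mems q hq)
    holomorphic_k := fun q hq => contMDiffAt_snd.comp q (hat q hq)
    holomorphic_proj := fun q hq => by
      refine (contMDiffAt_fst.comp q (hat q hq)).congr_of_eventuallyEq ?_
      filter_upwards [e.open_source.mem_nhds (mems q hq)] with p hp
      exact (h p hp).1.symm
    holomorphic_smul := fun x hx g => by
      refine (hes.contMDiffAt (e.open_target.mem_nhds (memt x hx g))).congr_of_eventuallyEq ?_
      filter_upwards [e.open_target.mem_nhds (memt x hx g)] with z hz
      rw [ht] at hz
      exact hsymm z.1 hz.1 z.2 }⟩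

theorem PrincipalAff.contMDiff_proj (Q : PrincipalAff B X n) :
    ContMDiff (𝓘(ℂ, B).prod (affI n)) 𝓘(ℂ, B) ω Q.proj := fun q => by
  obtain ⟨ℓ⟩ := Q.nonempty_localSection (Q.proj q)
  exact ℓ.holomorphic_proj q ℓ.mem_U

theorem PrincipalAff.LocalSection.holomorphic_σ {Q : PrincipalAff B X n} {x₀ : X}
    (ℓ : Q.LocalSection x₀) {x : X} (hx : x ∈ ℓ.U) :
    ContMDiffAt 𝓘(ℂ, B) (𝓘(ℂ, B).prod (affI n)) ω ℓ.σ x := by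
  refine ((ℓ.holomorphic_smul x hx 1).comp x
    (contMDiffAt_id.prodMk contMDiffAt_const)).congr_of_eventuallyEq ?_
  exact Filter.Eventually.of_forall fun y => (one_smul _ (ℓ.σ y)).symm

/-- A linear isomorphism onto a fibre of a vector bundle can be transported along an equality of
base points. -/
theorem exists_transport {Y F G : Type*} [AddCommGroup G] [Module ℂ G] {E : Y → Type*}
    [∀ x, AddCommGroup (E x)] [∀ x, Module ℂ (E x)] {x y : Y} (h : x = y) (e : G ≃ₗ[ℂ] E x) :
    ∃ e' : G ≃ₗ[ℂ] E y, ∀ v, (⟨y, e' v⟩ : TotalSpace F E) = ⟨x, e v⟩ := by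
  subst h
  exact ⟨e, fun _ => rfl⟩

/-! ### Evaluation maps: principal bundles versus extensions -/

namespace Extension

variable {V : HolVB.{u, u} B X (Fin n → ℂ)} {V' : HolVB.{u, u} B X (Fin n → ℂ)}

/-- The data witnessing that an extension is associated with a principal bundle. -/
structure Evaluation (S : Extension V) (Q : PrincipalAff B X n) where
  /-- the evaluation maps -/
  ev : ∀ q : Q.P, ((Fin n → ℂ) × ℂ) ≃ₗ[ℂ] S.W.E (Q.proj q)
  holomorphic : ContMDiff ((𝓘(ℂ, B).prod (affI n)).prod 𝓘(ℂ, (Fin n → ℂ) × ℂ))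
      (𝓘(ℂ, B).prod 𝓘(ℂ, (Fin n → ℂ) × ℂ)) ω
      (fun z : Q.P × ((Fin n → ℂ) × ℂ) => (⟨Q.proj z.1, ev z.1 z.2⟩ : S.W.Total))
  ev_smul : ∀ (q : Q.P) (g : Aff n) (y : (Fin n → ℂ) × ℂ),
      (⟨Q.proj (op g • q), ev (op g • q) y⟩ : S.W.Total) = ⟨Q.proj q, ev q (g.act y)⟩
  p_ev : ∀ (q : Q.P) (y : (Fin n → ℂ) × ℂ), S.p.lin (Q.proj q) (ev q y) = y.2

theorem isAssociated_iff {S : Extension V} {Q : PrincipalAff B X n} :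
    S.IsAssociated Q ↔ Nonempty (S.Evaluation Q) :=
  ⟨fun ⟨ev, h1, h2, h3⟩ => ⟨⟨ev, h1, h2, h3⟩⟩, fun ⟨⟨ev, h1, h2, h3⟩⟩ => ⟨ev, h1, h2, h3⟩⟩

namespace Evaluation

variable {S : Extension V} {S' : Extension V'} {Q Q' : PrincipalAff B X n}

/-- A local section of the principal bundle defines a local frame of the associated bundle. -/
theorem exists_frame (A : S.Evaluation Q) {x₀ : X} (ℓ : Q.LocalSection x₀) :
    ∃ b : ∀ x, ((Fin n → ℂ) × ℂ) →ₗ[ℂ] S.W.E x,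
      (∀ x ∈ ℓ.U, Function.Bijective (b x)) ∧
      (∀ x ∈ ℓ.U, ∀ v, S.p.lin x (b x v) = v.2) ∧
      (∀ x ∈ ℓ.U, ∀ v, ContMDiffAt 𝓘(ℂ, B) (𝓘(ℂ, B).prod 𝓘(ℂ, (Fin n → ℂ) × ℂ)) ω
        (fun x => (⟨x, b x v⟩ : S.W.Total)) x) ∧
      ∀ q, Q.proj q ∈ ℓ.U → ∀ v, A.ev q v = b (Q.proj q) ((ℓ.k q).act v) := by
  -- The frame at x is `ev` at σ x, transported along proj (σ x) = x; it is set to zero outside the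
  -- domain of the section.
  have h : ∀ x, ∃ b : ((Fin n → ℂ) × ℂ) →ₗ[ℂ] S.W.E x, x ∈ ℓ.U → Function.Bijective b ∧
      ∀ v, (⟨x, b v⟩ : S.W.Total) = ⟨Q.proj (ℓ.σ x), A.ev (ℓ.σ x) v⟩ := fun x => by
    by_cases hx : x ∈ ℓ.U
    · obtain ⟨e, he⟩ := exists_transport (F := (Fin n → ℂ) × ℂ) (ℓ.proj_σ x hx) (A.ev (ℓ.σ x))
      exact ⟨e.toLinearMap, fun _ => ⟨e.bijective, he⟩⟩
    · exact ⟨0, fun h => (hx h).elim⟩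
  choose b hb using h
  refine ⟨b, fun x hx => (hb x hx).1, fun x hx v => ?_, fun x hx v => ?_, fun q hq v => ?_⟩
  · exact (congrArg (fun z : S.W.Total => (S.p.lin z.proj z.snd : ℂ)) ((hb x hx).2 v)).trans
      (A.p_ev _ v)
  · refine ((A.holomorphic (ℓ.σ x, v)).comp (f := fun y => (ℓ.σ y, v)) x
      ((ℓ.holomorphic_σ hx).prodMk contMDiffAt_const)).congr_of_eventuallyEq ?_
    filter_upwards [ℓ.isOpen_U.mem_nhds hx] with y hy
    exact (hb y hy).2 v
  -- Write q = σ(x)·k(q) and use equivariance of `ev`.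
  · have h1 := A.ev_smul (ℓ.σ (Q.proj q)) (ℓ.k q) v
    rw [ℓ.smul_σ q hq, ← (hb _ hq).2] at h1
    exact eq_of_heq (TotalSpace.mk.inj h1).2

/-- A point of the principal bundle is determined by the frame of 𝓕 it defines: in a fixed frame `ev
q` is the matrix k q, and the affine group acts faithfully. -/
theorem smul_left (A : S.Evaluation Q) {q q' : Q.P} (h : Q.proj q = Q.proj q')
    (hev : ∀ v, (⟨Q.proj q, A.ev q v⟩ : S.W.Total) = ⟨Q.proj q', A.ev q' v⟩) : q = q' := by
  obtain ⟨ℓ⟩ := Q.nonempty_localSection (Q.proj q)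
  obtain ⟨b, hb, -, -, hk⟩ := A.exists_frame ℓ
  have hq := ℓ.mem_U
  have hq' : Q.proj q' ∈ ℓ.U := h ▸ hq
  have hkk : ℓ.k q = ℓ.k q' := by
    refine Aff.act_injective (funext fun v => (hb _ hq).1 ?_)
    have := hev v
    rw [hk q hq, hk q' hq', ← h] at this
    exact eq_of_heq (TotalSpace.mk.inj this).2
  rw [← ℓ.smul_σ q hq, ← ℓ.smul_σ q' hq', hkk]
  exact congrArg (fun x => op (ℓ.k q') • ℓ.σ x) h

/-- Two extensions associated with the same principal bundle have isomorphic middle terms. -/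
theorem exists_hom (A : S.Evaluation Q) (A' : S'.Evaluation Q) :
    ∃ f : HolVB.Hom S.W S'.W, ∀ q v, f.lin (Q.proj q) (A.ev q v) = A'.ev q v := by
  have h : ∀ x, ∃ f : S.W.E x →ₗ[ℂ] S'.W.E x,
      ∀ q (hq : Q.proj q = x) v, (⟨x, f (hq ▸ A.ev q v)⟩ : S'.W.Total) = ⟨Q.proj q, A'.ev q v⟩ := by
    intro x
    obtain ⟨ℓ⟩ := Q.nonempty_localSection x
    obtain ⟨b, hb, -, -, hk⟩ := A.exists_frame ℓ
    obtain ⟨b', hb', -, -, hk'⟩ := A'.exists_frame ℓ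
    -- This is ev'(q) ∘ ev(q)⁻¹ for every q over x: the same matrix k q occurs in both factors and
    -- cancels.
    refine ⟨(b' x).comp (LinearEquiv.ofBijective (b x) (hb x ℓ.mem_U)).symm.toLinearMap, ?_⟩
    rintro q rfl v
    refine congrArg (TotalSpace.mk (Q.proj q)) ?_
    change b' _ ((LinearEquiv.ofBijective (b _) (hb _ ℓ.mem_U)).symm (A.ev q v)) = A'.ev q v
    rw [hk q ℓ.mem_U, hk' q ℓ.mem_U]
    exact congrArg _ ((LinearEquiv.ofBijective (b _) (hb _ ℓ.mem_U)).symm_apply_apply _)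
  choose f hf using h
  have hf' : ∀ q v, f (Q.proj q) (A.ev q v) = A'.ev q v := fun q v =>
    eq_of_heq (TotalSpace.mk.inj (hf _ q rfl v)).2
  refine ⟨⟨f, HolVB.contMDiff_of_frames _ _ f fun x₀ => ?_⟩, hf'⟩
  obtain ⟨ℓ⟩ := Q.nonempty_localSection x₀
  obtain ⟨b, hb, -, hbh, hk⟩ := A.exists_frame ℓ
  obtain ⟨b', -, -, hbh', hk'⟩ := A'.exists_frame ℓ
  have hU := ℓ.isOpen_U.mem_nhds ℓ.mem_U
  refine ⟨b, Filter.eventually_of_mem hU hb, fun v => hbh x₀ ℓ.mem_U v, fun v => ?_⟩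
  refine (hbh' x₀ ℓ.mem_U v).congr_of_eventuallyEq (Filter.eventually_of_mem hU fun x hx => ?_)
  have h1 := hf' (ℓ.σ x) v
  have hx' : Q.proj (ℓ.σ x) ∈ ℓ.U := (ℓ.proj_σ x hx).symm ▸ hx
  rw [hk _ hx', hk' _ hx', ℓ.k_σ x hx, Aff.one_act, ℓ.proj_σ x hx] at h1
  exact congrArg (TotalSpace.mk x) h1

/-- Two principal bundles with which the same extension is associated are related by a morphism
compatible with the evaluation maps. -/
theorem exists_principal_hom (A : S.Evaluation Q) (A' : S.Evaluation Q') :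
    ∃ h : PrincipalAff.Hom Q Q', ∀ q v,
      (⟨Q'.proj (h.toFun q), A'.ev (h.toFun q) v⟩ : S.W.Total) = ⟨Q.proj q, A.ev q v⟩ := by
  have hex : ∀ q, ∃ q', Q'.proj q' = Q.proj q ∧
      ∀ v, (⟨Q'.proj q', A'.ev q' v⟩ : S.W.Total) = ⟨Q.proj q, A.ev q v⟩ := by
    intro q
    obtain ⟨ℓ⟩ := Q'.nonempty_localSection (Q.proj q)
    obtain ⟨b, hb, hp, -, hk⟩ := A'.exists_frame ℓ
    let β := LinearEquiv.ofBijective (b (Q.proj q)) (hb _ ℓ.mem_U)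
    -- Relative to the frame of Q' at σ, `ev q` preserves the last coordinate, as both are
    -- compatible with the projection of 𝓕. It is thus given by an affine g, and q is sent to σ·g.
    obtain ⟨g, hg⟩ := Aff.exists_act_eq ((A.ev q).trans β.symm) fun y => by
      have h1 := hp _ ℓ.mem_U (β.symm (A.ev q y))
      rw [show b (Q.proj q) (β.symm (A.ev q y)) = A.ev q y from β.apply_symm_apply _,
        A.p_ev] at h1
      exact h1.symm
    have hσ := ℓ.proj_σ _ ℓ.mem_U
    have hpr : Q'.proj (op g • ℓ.σ (Q.proj q)) = Q.proj q := by rw [Q'.proj_smul, hσ]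
    refine ⟨op g • ℓ.σ (Q.proj q), hpr, fun v => ?_⟩
    have hkg : ℓ.k (op g • ℓ.σ (Q.proj q)) = g := by
      rw [ℓ.k_smul _ _ (by rw [hσ]; exact ℓ.mem_U), ℓ.k_σ _ ℓ.mem_U, one_mul]
    rw [hk _ (by rw [hpr]; exact ℓ.mem_U), hkg, hpr, hg]
    exact congrArg (TotalSpace.mk (Q.proj q)) (β.apply_symm_apply _)
  choose h hproj hev using hex
  refine ⟨⟨h, fun q₀ => ?_, fun g q => ?_, hproj⟩, hev⟩
  · obtain ⟨ℓ⟩ := Q'.nonempty_localSection (Q.proj q₀)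
    obtain ⟨b, hb, -, hbh, hk⟩ := A'.exists_frame ℓ
    have hpr := Q.contMDiff_proj q₀
    have hU := hpr.continuousAt.preimage_mem_nhds (ℓ.isOpen_U.mem_nhds ℓ.mem_U)
    -- The block matrix of k(h q) consists of the coordinates of the holomorphic sections ev q v in
    -- the frame b.
    have hkh : ContMDiffAt (𝓘(ℂ, B).prod (affI n)) (affI n) ω (fun q => ℓ.k (h q)) q₀ := by
      refine Aff.contMDiffAt_iff_actL.2 (contMDiffAt_clm_of_apply fun v => ?_)
      refine S.W.contMDiffAt_coord (a := Q.proj) (s := fun q => A.ev q v)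
        (b := fun q => b (Q.proj q)) (hb _ ℓ.mem_U).1
        (fun v => (hbh _ ℓ.mem_U v).comp q₀ hpr) ?_ ?_
      · exact (A.holomorphic (q₀, v)).comp (f := fun q => (q, v)) q₀
          (contMDiffAt_id.prodMk contMDiffAt_const)
      · filter_upwards [hU] with q hq
        have h1 := hev q v
        rw [hk _ (by rw [hproj]; exact hq), hproj] at h1
        exact eq_of_heq (TotalSpace.mk.inj h1).2
    refine ((ℓ.holomorphic_smul _ ℓ.mem_U (ℓ.k (h q₀))).comp (f := fun q => (Q.proj q, ℓ.k (h q)))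
      q₀ (hpr.prodMk hkh)).congr_of_eventuallyEq ?_
    filter_upwards [hU] with q hq
    have h1 := ℓ.smul_σ (h q) (by rw [hproj]; exact hq)
    rw [hproj] at h1
    exact h1.symm
  · refine A'.smul_left ?_ fun v => ?_
    · rw [hproj, Q.proj_smul, Q'.proj_smul, hproj]
    · rw [hev, A.ev_smul, A'.ev_smul, hev]

/-- Two principal bundles with which the same extension is associated are isomorphic. -/
theorem nonempty_iso (A : S.Evaluation Q) (A' : S.Evaluation Q') : Nonempty (Q ≅ Q') := by
  obtain ⟨h, hh⟩ := A.exists_principal_hom A'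
  obtain ⟨k, hk⟩ := A'.exists_principal_hom A
  refine ⟨⟨h, k, PrincipalAff.Hom.ext (funext fun q => A.smul_left ?_ fun v => ?_),
    PrincipalAff.Hom.ext (funext fun q => A'.smul_left ?_ fun v => ?_)⟩⟩
  · exact (k.map_proj _).trans (h.map_proj _)
  · exact (hk _ v).trans (hh q v)
  · exact (h.map_proj _).trans (k.map_proj _)
  · exact (hh _ v).trans (hk q v)

/-- Transport of an evaluation along an isomorphism of the middle terms. -/
noncomputable def map (A : S.Evaluation Q) (f : HolVB.Hom S.W S'.W)
    (hf : ∀ x, Function.Bijective (f.lin x))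
    (hp : ∀ x w, (S'.p.lin x (f.lin x w) : ℂ) = S.p.lin x w) : S'.Evaluation Q where
  ev q := (A.ev q).trans (LinearEquiv.ofBijective (f.lin _) (hf _))
  holomorphic := f.holomorphic'.comp A.holomorphic
  ev_smul q g y := congrArg (fun z : S.W.Total => (⟨z.proj, f.lin z.proj z.snd⟩ : S'.W.Total))
    (A.ev_smul q g y)
  p_ev q y := (hp _ _).trans (A.p_ev q y)

/-- Transport of an evaluation along an isomorphism of principal bundles. -/
theorem exists_of_iso (A : S.Evaluation Q) (φ : Q ≅ Q') : Nonempty (S.Evaluation Q') := by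
  let ψ : PrincipalAff.Hom Q' Q := φ.inv
  choose ev hev using fun q => exists_transport (F := (Fin n → ℂ) × ℂ) (ψ.map_proj q)
    (A.ev (ψ.toFun q))
  refine ⟨⟨ev, ?_, fun q g y => ?_, fun q y => ?_⟩⟩
  · simp_rw [hev]
    exact A.holomorphic.comp (f := fun z : Q'.P × ((Fin n → ℂ) × ℂ) => (ψ.toFun z.1, z.2))
      ((ψ.holomorphic.comp contMDiff_fst).prodMk contMDiff_snd)
  · rw [hev, hev, ψ.map_smul, A.ev_smul]
  · exact (congrArg (fun z : S.W.Total => (S.p.lin z.proj z.snd : ℂ)) (hev q y)).trans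
      (A.p_ev _ y)

end Evaluation

end Extension

end AffineBundle
-- Functoriality of the extension class
namespace AffineBundle

open MulOpposite

variable {B : Type w} [NormedAddCommGroup B] [NormedSpace ℂ B]
  {X : Type u} [TopologicalSpace X] [ChartedSpace B X] {n : ℕ}

namespace Extension

variable {V V' : HolVB.{u, u} B X (Fin n → ℂ)}

/-- A morphism of extensions of `𝓞_X` induces a morphism of complexes of sheaves. -/
noncomputable def complexMap {S : Extension V} {S' : Extension V'} (g : HolVB.Hom V V')
    (f : HolVB.Hom S.W S'.W) (hi : ∀ x v, S'.i.lin x (g.lin x v) = f.lin x (S.i.lin x v))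
    (hp : ∀ x w, (S'.p.lin x (f.lin x w) : ℂ) = S.p.lin x w) : S.complex ⟶ S'.complex where
  τ₁ := g.sheafMap
  τ₂ := f.sheafMap
  τ₃ := 𝟙 _
  comm₁₂ := by
    refine Sheaf.hom_ext (NatTrans.ext (funext fun U => ?_))
    exact AddCommGrpCat.hom_ext (AddMonoidHom.ext fun s => Subtype.ext (funext fun x => hi x.1 _))
  comm₂₃ := by
    refine Sheaf.hom_ext (NatTrans.ext (funext fun U => ?_))
    exact AddCommGrpCat.hom_ext (AddMonoidHom.ext fun s => Subtype.ext (funext fun x => hp x.1 _))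

/-- Naturality of the class of an extension. -/
theorem H1_map_cls {S : Extension V} {S' : Extension V'} (g : V ⟶ V')
    (f : HolVB.Hom S.W S'.W)
    (hi : ∀ x v, S'.i.lin x (HolVB.Hom.lin g x v) = f.lin x (S.i.lin x v))
    (hp : ∀ x w, (S'.p.lin x (f.lin x w) : ℂ) = S.p.lin x w) :
    (H1 B X (Fin n → ℂ)).map g S.cls = S'.cls := by
  have h := ShortComplex.ShortExact.extClass_naturality S.shortExact S'.shortExact
    (complexMap g f hi hp)
  have h1 : (H1 B X (Fin n → ℂ)).map g S.cls =
      S.cls.comp (Abelian.Ext.mk₀ (HolVB.Hom.sheafMap g)) (add_zero 1) := rfl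
  rw [h1]
  unfold cls
  -- Naturality exchanges g on the kernels for the third component of the morphism of complexes,
  -- which is the identity of `𝓞_X`.
  refine (Abelian.Ext.comp_assoc_of_third_deg_zero _ _ _ _).trans ?_
  refine congrArg (fun z => Abelian.Ext.comp _ z (zero_add 1)) (h.trans ?_)
  exact Abelian.Ext.mk₀_id_comp _

/-- A morphism of middle terms over `𝓞_X` restricts to the kernels. -/
theorem exists_restrict {S : Extension V} {S' : Extension V'} (f : HolVB.Hom S.W S'.W)
    (hp : ∀ x w, (S'.p.lin x (f.lin x w) : ℂ) = S.p.lin x w) :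
    ∃ g : HolVB.Hom V V', ∀ x v, S'.i.lin x (g.lin x v) = f.lin x (S.i.lin x v) := by
  have h : ∀ x v, ∃ v', S'.i.lin x v' = f.lin x (S.i.lin x v) := fun x v =>
    (S'.exact x _).1 ((hp x _).trans ((S.exact x).apply_apply_eq_zero v))
  have h' : ∀ x, ∃ g : V.E x →ₗ[ℂ] V'.E x, ∀ v, S'.i.lin x (g v) = f.lin x (S.i.lin x v) := by
    intro x
    choose g hg using h x
    refine ⟨⟨⟨g, fun a b => S'.injective x ?_⟩, fun r a => S'.injective x ?_⟩, hg⟩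
    · simp only [map_add, hg]
    · change S'.i.lin x (g (r • a)) = S'.i.lin x (r • g a)
      simp only [map_smul, hg]
  choose g hg using h'
  exact ⟨⟨g, HolVB.contMDiff_of_comp_injective g S'.i S'.injective
    ⟨fun x => (f.lin x).comp (S.i.lin x), f.holomorphic'.comp S.i.holomorphic'⟩ hg⟩, hg⟩

/-- The extension obtained by replacing the kernel by an isomorphic bundle. -/
noncomputable def ofIso (S : Extension V) (φ : V ≅ V') : Extension V' where
  W := S.W
  i := ⟨fun x => (S.i.lin x).comp (HolVB.Hom.lin φ.inv x),
    S.i.holomorphic'.comp (HolVB.Hom.holomorphic' φ.inv)⟩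
  p := S.p
  injective x := (S.injective x).comp (Function.LeftInverse.injective
    (g := HolVB.Hom.lin φ.hom x)
    (fun v => LinearMap.congr_fun (congrFun (congrArg HolVB.Hom.lin φ.inv_hom_id) x) v))
  exact x w := by
    refine (S.exact x w).trans ⟨?_, ?_⟩
    · rintro ⟨v, rfl⟩
      refine ⟨HolVB.Hom.lin φ.hom x v, congrArg (S.i.lin x) ?_⟩
      exact LinearMap.congr_fun (congrFun (congrArg HolVB.Hom.lin φ.hom_inv_id) x) v
    · rintro ⟨v, rfl⟩
      exact ⟨_, rfl⟩
  surjective := S.surjective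

/-- Both extensions have the same middle term, so naturality applies with the identity there and φ
on the kernels. -/
theorem cls_ofIso (S : Extension V) (φ : V ≅ V') :
    (S.ofIso φ).cls = (H1 B X (Fin n → ℂ)).map φ.hom S.cls := by
  refine (H1_map_cls φ.hom ⟨fun x => LinearMap.id, contMDiff_id⟩ (fun x v => ?_)
    fun _ _ => rfl).symm
  exact congrArg (S.i.lin x)
    (LinearMap.congr_fun (congrFun (congrArg HolVB.Hom.lin φ.hom_inv_id) x) v)

/-- The pairs attached to a principal bundle are isomorphic. -/
theorem Evaluation.exists_kernel_iso {S : Extension V} {S' : Extension V'} {Q : PrincipalAff B X n}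
    (A : S.Evaluation Q) (A' : S'.Evaluation Q) :
    ∃ φ : V ≅ V', (H1 B X (Fin n → ℂ)).map φ.hom S.cls = S'.cls := by
  obtain ⟨f, hf⟩ := A.exists_hom A'
  obtain ⟨f', hf'⟩ := A'.exists_hom A
  -- Every vector of 𝓕 is of the form ev q v, so identities between morphisms of middle terms need
  -- only be checked on these.
  have hsurj : ∀ x, ∃ q, Q.proj q = x := fun x => by
    obtain ⟨ℓ⟩ := Q.nonempty_localSection x
    exact ⟨_, ℓ.proj_σ x ℓ.mem_U⟩
  have hp : ∀ x w, (S'.p.lin x (f.lin x w) : ℂ) = S.p.lin x w := fun x w => by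
    obtain ⟨q, rfl⟩ := hsurj x
    obtain ⟨v, rfl⟩ := (A.ev q).surjective w
    rw [hf]
    exact (A'.p_ev q v).trans (A.p_ev q v).symm
  have hp' : ∀ x w, (S.p.lin x (f'.lin x w) : ℂ) = S'.p.lin x w := fun x w => by
    obtain ⟨q, rfl⟩ := hsurj x
    obtain ⟨v, rfl⟩ := (A'.ev q).surjective w
    rw [hf']
    exact (A.p_ev q v).trans (A'.p_ev q v).symm
  have hff' : ∀ x w, f'.lin x (f.lin x w) = w := fun x w => by
    obtain ⟨q, rfl⟩ := hsurj x
    obtain ⟨v, rfl⟩ := (A.ev q).surjective w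
    rw [hf, hf']
  have hf'f : ∀ x w, f.lin x (f'.lin x w) = w := fun x w => by
    obtain ⟨q, rfl⟩ := hsurj x
    obtain ⟨v, rfl⟩ := (A'.ev q).surjective w
    rw [hf', hf]
  obtain ⟨g, hg⟩ := exists_restrict f hp
  obtain ⟨g', hg'⟩ := exists_restrict f' hp'
  refine ⟨⟨g, g', ?_, ?_⟩, H1_map_cls g f hg hp⟩
  · refine HolVB.Hom.ext (funext fun x => LinearMap.ext fun v => S.injective x ?_)
    exact (hg' x _).trans ((congrArg _ (hg x v)).trans (hff' x _))
  · refine HolVB.Hom.ext (funext fun x => LinearMap.ext fun v => S'.injective x ?_)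
    exact (hg x _).trans ((congrArg _ (hg' x v)).trans (hf'f x _))

end Extension

/-! ### The extension of an affine cocycle -/

namespace AffCocycle

variable (c : AffCocycle B X n)

/-- The extension defined by an affine cocycle, with kernel any bundle which in suitable fibre
coordinates `θ` is given by the cocycle of linear parts. -/
noncomputable def extension (V : HolVB.{u, u} B X (Fin n → ℂ))
    (θ : ∀ x, V.E x ≃ₗ[ℂ] (Fin n → ℂ))
    (hθ : ∀ j (z : V.Total), z.proj ∈ c.U j → ContMDiffAt (𝓘(ℂ, B).prod 𝓘(ℂ, Fin n → ℂ))
      𝓘(ℂ, Fin n → ℂ) ω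
      (fun z : V.Total => (c.g j z.proj z.proj).lin.1 (θ z.proj z.snd)) z) :
    Extension V where
  W := c.toLinear.bundle
  i :=
    { lin := fun x => (ULift.moduleEquiv.symm : ((Fin n → ℂ) × ℂ) ≃ₗ[ℂ] _).toLinearMap.comp
        ((LinearMap.inl ℂ (Fin n → ℂ) ℂ).comp (θ x).toLinearMap)
      holomorphic' := fun z => by
        refine (c.toLinear.contMDiffAt_total_iff (a := fun z : V.Total => z.proj)
          (v := fun z => (θ z.proj z.snd, 0)) z.proj (c.mem_U z.proj)).2
          ⟨(Bundle.contMDiff_proj V.E).contMDiffAt, ?_⟩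
        -- On ℂⁿ × 0 a block matrix acts through its linear part alone, so the inclusion in
        -- coordinates is the map controlled by `hθ`.
        refine ((hθ z.proj z (c.mem_U z.proj)).prodMk_space
          (contMDiffAt_const (c := (0 : ℂ)))).congr_of_eventuallyEq ?_
        refine Filter.Eventually.of_forall fun y => Prod.ext ?_ rfl
        change (c.g z.proj y.proj y.proj).lin.1 (θ y.proj y.snd) +
          (0 : ℂ) • (c.g z.proj y.proj y.proj).trans = _
        rw [zero_smul, add_zero] }
  p :=
    { lin := fun x => (LinearMap.snd ℂ (Fin n → ℂ) ℂ).comp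
        (ULift.moduleEquiv : _ ≃ₗ[ℂ] ((Fin n → ℂ) × ℂ)).toLinearMap
      holomorphic' := fun z => by
        have h := (c.toLinear.contMDiffAt_total_iff (a := fun z : c.toLinear.bundle.Total => z.proj)
          (v := fun z => ULift.down z.snd) z.proj (c.mem_U z.proj)).1 contMDiffAt_id
        -- Block matrices preserve the last coordinate, so it is the same in the stored vector and
        -- in any trivialization.
        refine contMDiffAt_totalSpace.2 ⟨h.1, ContMDiffAt.congr_of_eventuallyEq
          ((ContinuousLinearMap.snd ℂ (Fin n → ℂ) ℂ).contMDiff.contMDiffAt.comp z h.2) ?_⟩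
        exact Filter.Eventually.of_forall fun _ => rfl }
  injective x v v' h := (θ x).injective (congrArg (fun w : ULift ((Fin n → ℂ) × ℂ) => w.down.1) h)
  exact x w := by
    constructor
    · intro h
      refine ⟨(θ x).symm (ULift.down w).1, ?_⟩
      refine ULift.ext _ _ (Prod.ext ((θ x).apply_symm_apply _) ?_)
      exact Eq.symm h
    · rintro ⟨v, rfl⟩
      rfl
  surjective x r := ⟨ULift.up (0, r), rfl⟩

variable [IsManifold 𝓘(ℂ, B) ω X]

/-- The extension of a cocycle is associated with the principal bundle of the cocycle. -/
noncomputable def evaluation (V : HolVB.{u, u} B X (Fin n → ℂ))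
    (θ : ∀ x, V.E x ≃ₗ[ℂ] (Fin n → ℂ))
    (hθ : ∀ j (z : V.Total), z.proj ∈ c.U j → ContMDiffAt (𝓘(ℂ, B).prod 𝓘(ℂ, Fin n → ℂ))
      𝓘(ℂ, Fin n → ℂ) ω
      (fun z : V.Total => (c.g j z.proj z.proj).lin.1 (θ z.proj z.snd)) z) :
    (c.extension V θ hθ).Evaluation c.principal where
  ev q := (Aff.actEquiv (Prod.snd q)).trans ULift.moduleEquiv.symm
  holomorphic := by
    rintro ⟨q, v⟩
    refine (c.toLinear.contMDiffAt_total_iff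
      (a := fun z : c.principal.P × ((Fin n → ℂ) × ℂ) => c.principal.proj z.1)
      (v := fun z => Aff.act (Prod.snd z.1) z.2) (c.principal.proj q) (c.mem_U _)).2 ⟨?_, ?_⟩
    · exact (c.principal.contMDiff_proj q).comp (q, v) contMDiffAt_fst
    · have h1 := (c.contMDiffOn_chartHomeo q.1).1.contMDiffAt
        ((c.chartHomeo q.1).open_source.mem_nhds (c.mem_U q.1))
      have h2 := Aff.contMDiffAt_iff_actL.1 (contMDiffAt_snd.comp q h1)
      -- In the trivialization of index i the vector a·v over x becomes (g_ix a)·v, and g_ix a is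
      -- the group coordinate of the chart of index i.
      refine ((h2.comp (q, v) contMDiffAt_fst).clm_apply contMDiffAt_snd).congr_of_eventuallyEq ?_
      refine Filter.Eventually.of_forall fun z => ?_
      exact (Aff.act_mul _ _ _).symm
  ev_smul q g y := by
    refine congrArg (TotalSpace.mk q.1) ?_
    exact congrArg ULift.up (Aff.act_mul _ _ _)
  p_ev q y := rfl

end AffCocycle

/-! ### The extension attached to a principal bundle -/

namespace PrincipalAff

variable (Q : PrincipalAff B X n) (ℓ : ∀ x, Q.LocalSection x)

/-- Apply the coordinate of ℓ to q = σ'(x)·k'(q), where σ' and k' belong to ℓ'. This yields both the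
cocycle identity and the change of coordinates of a point. -/
theorem LocalSection.k_mul_k {Q : PrincipalAff B X n} {i j : X} (ℓ : Q.LocalSection i)
    (ℓ' : Q.LocalSection j) {q : Q.P} (hi : Q.proj q ∈ ℓ.U) (hj : Q.proj q ∈ ℓ'.U) :
    ℓ.k (ℓ'.σ (Q.proj q)) * ℓ'.k q = ℓ.k q := by
  rw [← ℓ.k_smul _ _ (by rwa [ℓ'.proj_σ _ hj]), ℓ'.smul_σ q hj]

/-- The transition functions of a principal bundle with respect to a family of local sections. -/
noncomputable def cocycle : AffCocycle B X n where
  U x := (ℓ x).U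
  isOpen_U x := (ℓ x).isOpen_U
  mem_U x := (ℓ x).mem_U
  g i j x := (ℓ i).k ((ℓ j).σ x)
  holomorphic i j x hi hj :=
    ((ℓ i).holomorphic_k _ (by rwa [(ℓ j).proj_σ x hj])).comp x ((ℓ j).holomorphic_σ hj)
  g_self i x hx := (ℓ i).k_σ x hx
  g_comp i j k x hi hj hk := by
    have h := (ℓ k).proj_σ x hk
    have h1 := (ℓ i).k_mul_k (ℓ j) (q := (ℓ k).σ x) (by rwa [h]) (by rwa [h])
    rwa [h] at h1

/-- Every principal bundle has an associated extension. -/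
theorem exists_evaluation :
    ∃ (V : HolVB.{u, u} B X (Fin n → ℂ)) (S : Extension V), Nonempty (S.Evaluation Q) := by
  obtain ⟨ℓ⟩ : Nonempty (∀ x, Q.LocalSection x) :=
    ⟨fun x => Classical.choice (Q.nonempty_localSection x)⟩
  let c := Q.cocycle ℓ
  refine ⟨c.linPart.bundle, c.extension _ (fun _ => ULift.moduleEquiv) fun j z hz =>
    ((c.linPart.contMDiffAt_total_iff (a := fun z : c.linPart.bundle.Total => z.proj)
      (v := fun z => ULift.down z.snd) j hz).1 contMDiffAt_id).2, ⟨⟨fun q =>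
      (Aff.actEquiv ((ℓ (Q.proj q)).k q)).trans ULift.moduleEquiv.symm, ?_, ?_, ?_⟩⟩⟩
  · rintro ⟨q, v⟩
    have hq := (ℓ (Q.proj q)).mem_U
    have hp : ContMDiffAt ((𝓘(ℂ, B).prod (affI n)).prod 𝓘(ℂ, (Fin n → ℂ) × ℂ)) 𝓘(ℂ, B) ω
        (fun z : Q.P × ((Fin n → ℂ) × ℂ) => Q.proj z.1) (q, v) :=
      (Q.contMDiff_proj q).comp (q, v) contMDiffAt_fst
    refine (c.toLinear.contMDiffAt_total_iff
      (a := fun z : Q.P × ((Fin n → ℂ) × ℂ) => Q.proj z.1)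
      (v := fun z => Aff.act ((ℓ (Q.proj z.1)).k z.1) z.2) (m := (q, v)) (Q.proj q) hq).2 ⟨hp, ?_⟩
    have h1 := Aff.contMDiffAt_iff_actL.1 ((ℓ (Q.proj q)).holomorphic_k q hq)
    refine ((h1.comp (q, v) contMDiffAt_fst).clm_apply contMDiffAt_snd).congr_of_eventuallyEq ?_
    filter_upwards [hp.continuousAt.preimage_mem_nhds ((ℓ (Q.proj q)).isOpen_U.mem_nhds hq)]
      with z hz
    refine (Aff.act_mul _ _ _).symm.trans ?_
    exact congrArg (fun g : Aff n => g.act z.2)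
      ((ℓ (Q.proj q)).k_mul_k (ℓ (Q.proj z.1)) hz (ℓ (Q.proj z.1)).mem_U)
  · intro q g y
    -- The local section used for q·g is indexed by proj (q·g); freeing this index x permits
    -- substitution of proj q.
    have h : ∀ x, x = Q.proj q →
        (⟨x, ULift.up (((ℓ x).k (op g • q)).act y)⟩ : c.toLinear.bundle.Total) =
          ⟨Q.proj q, ULift.up (((ℓ (Q.proj q)).k q).act (g.act y))⟩ := by
      rintro _ rfl
      rw [(ℓ _).k_smul g q (ℓ _).mem_U, Aff.act_mul]
    exact h _ (Q.proj_smul g q)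
  · intro q y
    rfl

end PrincipalAff

end AffineBundle
-- Cocycle description of the connecting homomorphism
namespace AffineBundle

open Opposite Abelian

/-- The category of abelian sheaves on a topological space. -/
abbrev AbSheaf (X : TopCat.{u}) := Sheaf (Opens.grothendieckTopology X) AddCommGrpCat.{u}

section SheafSequences

variable {X : TopCat.{u}}

variable {T : ShortComplex (AbSheaf X)} (hT : T.ShortExact)

include hT in
theorem sections_injective (U : (Opens X)ᵒᵖ) : Function.Injective (T.f.hom.app U) := by
  have : Mono T.f := hT.mono_f
  have h : Mono ((sheafToPresheaf _ _ ⋙ (evaluation _ _).obj U).map T.f) := inferInstance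
  exact (AddCommGrpCat.mono_iff_injective _).1 h

include hT in
-- Taking sections over an open set is left exact.
theorem exists_of_sections_eq_zero {U : (Opens X)ᵒᵖ} (t : T.X₂.obj.obj U)
    (ht : T.g.hom.app U t = 0) : ∃ v, T.f.hom.app U v = t := by
  have : Mono T.f := hT.mono_f
  have h := hT.exact.map_of_mono_of_preservesKernel
    (sheafToPresheaf _ AddCommGrpCat.{u} ⋙ (evaluation _ _).obj U) inferInstance inferInstance
  exact (ShortComplex.ab_exact_iff _).1 h t ht

include hT in
theorem exists_local_lift {U : Opens X} (s : T.X₃.obj.obj (op U)) {x : X} (hx : x ∈ U) :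
    ∃ (U' : Opens X) (h : U' ≤ U) (t : T.X₂.obj.obj (op U')), x ∈ U' ∧
      T.g.hom.app (op U') t = T.X₃.obj.map (homOfLE h).op s := by
  obtain ⟨U', h, ⟨t, ht⟩, hx'⟩ := (TopCat.Presheaf.isLocallySurjective_iff _).1
    ((TopCat.Sheaf.isLocallySurjective_iff_epi T.g).2 hT.epi_g) U s x hx
  exact ⟨U', h, t, hx', ht⟩

theorem app_res {F G : AbSheaf X} (f : F ⟶ G) {U U' : Opens X} (h : U' ≤ U)
    (s : F.obj.obj (op U)) :
    f.hom.app (op U') (F.obj.map (homOfLE h).op s) = G.obj.map (homOfLE h).op (f.hom.app (op U) s) :=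
  NatTrans.naturality_apply f.hom _ s

theorem res_res (F : AbSheaf X) {U U' U'' : Opens X} (h : U' ≤ U) (h' : U'' ≤ U')
    (s : F.obj.obj (op U)) :
    F.obj.map (homOfLE h').op (F.obj.map (homOfLE h).op s) =
      F.obj.map (homOfLE (h'.trans h)).op s := by
  rw [← ConcreteCategory.comp_apply, ← Functor.map_comp]
  rfl

theorem comm₁₂_app {S T : ShortComplex (AbSheaf X)} (φ : S ⟶ T) {U : (Opens X)ᵒᵖ}
    (s : S.X₁.obj.obj U) :
    φ.τ₂.hom.app U (S.f.hom.app U s) = T.f.hom.app U (φ.τ₁.hom.app U s) :=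
  (ConcreteCategory.congr_hom (NatTrans.congr_app (congrArg (fun ψ => ψ.hom) φ.comm₁₂) U) s).symm

theorem comm₂₃_app {S T : ShortComplex (AbSheaf X)} (φ : S ⟶ T) {U : (Opens X)ᵒᵖ}
    (s : S.X₂.obj.obj U) :
    T.g.hom.app U (φ.τ₂.hom.app U s) = φ.τ₃.hom.app U (S.g.hom.app U s) :=
  ConcreteCategory.congr_hom (NatTrans.congr_app (congrArg (fun ψ => ψ.hom) φ.comm₂₃) U) s

theorem zero_app (T : ShortComplex (AbSheaf X)) {U : (Opens X)ᵒᵖ} (s : T.X₁.obj.obj U) :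
    T.g.hom.app U (T.f.hom.app U s) = 0 :=
  ConcreteCategory.congr_hom (NatTrans.congr_app (congrArg (fun ψ => ψ.hom) T.zero) U) s

/-- The connecting homomorphism on global sections. -/
noncomputable def connecting (s : T.X₃.obj.obj (op (⊤ : Opens X))) : T.X₁.H 1 :=
  ((Sheaf.H.equiv₀ T.X₃ (Limits.isTerminalTop (α := Opens X))).symm s).comp
    hT.extClass (zero_add 1)

theorem connecting_sub (s s' : T.X₃.obj.obj (op (⊤ : Opens X))) :
    connecting hT (s - s') = connecting hT s - connecting hT s' := by
  unfold connecting
  rw [map_sub, sub_eq_add_neg, Ext.add_comp, Ext.neg_comp, sub_eq_add_neg]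

/-- Exactness of the long cohomology sequence at H⁰ of the third term. -/
theorem connecting_eq_zero_iff (s : T.X₃.obj.obj (op (⊤ : Opens X))) :
    connecting hT s = 0 ↔ ∃ r, T.g.hom.app (op ⊤) r = s := by
  constructor
  · intro h
    obtain ⟨y, hy⟩ := Ext.covariant_sequence_exact₃ _ hT _ _ h
    refine ⟨Sheaf.H.equiv₀ T.X₂ Limits.isTerminalTop y, ?_⟩
    rw [Sheaf.H.equiv₀_naturality, Sheaf.H.map_apply, hy, AddEquiv.apply_symm_apply]
  · rintro ⟨r, rfl⟩
    unfold connecting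
    rw [← Sheaf.H.equiv₀_symm_naturality, Sheaf.H.map_apply, Ext.comp_assoc_of_second_deg_zero,
      ShortComplex.ShortExact.comp_extClass, Ext.comp_zero]

/-- H¹ of an injective sheaf vanishes, so the connecting map is onto. -/
theorem exists_connecting_eq [Injective T.X₂] (χ : T.X₁.H 1) : ∃ s, connecting hT s = χ := by
  obtain ⟨y, hy⟩ := Ext.covariant_sequence_exact₁ _ hT χ (Ext.eq_zero_of_injective _) rfl
  exact ⟨Sheaf.H.equiv₀ T.X₃ Limits.isTerminalTop y, by
    unfold connecting; rw [AddEquiv.symm_apply_apply]; exact hy⟩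

theorem connecting_naturality {S : ShortComplex (AbSheaf X)} (hS : S.ShortExact) (φ : S ⟶ T)
    (s : S.X₃.obj.obj (op (⊤ : Opens X))) :
    Sheaf.H.map φ.τ₁ 1 (connecting hS s) = connecting hT (φ.τ₃.hom.app (op ⊤) s) := by
  unfold connecting
  rw [← Sheaf.H.equiv₀_symm_naturality, Sheaf.H.map_apply, Sheaf.H.map_apply,
    Ext.comp_assoc_of_third_deg_zero, ShortComplex.ShortExact.extClass_naturality hS hT,
    Ext.comp_assoc_of_second_deg_zero]

/-- Any morphism of kernels extends to a morphism to a short exact sequence with injective middle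
term. -/
theorem exists_map_of_injective {S T : ShortComplex (AbSheaf X)} (hS : S.ShortExact)
    [Injective T.X₂] (e : S.X₁ ⟶ T.X₁) : ∃ φ : S ⟶ T, φ.τ₁ = e := by
  have : Mono S.f := hS.mono_f
  have : Epi S.g := hS.epi_g
  have h : S.f ≫ Injective.factorThru (e ≫ T.f) S.f = e ≫ T.f := Injective.comp_factorThru _ _
  refine ⟨{
    τ₁ := e
    τ₂ := Injective.factorThru (e ≫ T.f) S.f
    τ₃ := hS.exact.desc (Injective.factorThru (e ≫ T.f) S.f ≫ T.g) (by
      rw [← Category.assoc, h, Category.assoc, T.zero, Limits.comp_zero])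
    comm₁₂ := h.symm
    comm₂₃ := (hS.exact.g_desc _ _).symm }, rfl⟩

/-- Two classes agree if they can be represented by the same cocycle of differences of local
lifts. -/
theorem connecting_eq_of_local_lifts {S : ShortComplex (AbSheaf X)} (hS : S.ShortExact) (φ : S ⟶ T)
    (σ : S.X₃.obj.obj (op (⊤ : Opens X))) (s : T.X₃.obj.obj (op (⊤ : Opens X)))
    {ι : Type u} (U : ι → Opens X) (hU : ⊤ ≤ iSup U)
    (a : ∀ i, S.X₂.obj.obj (op (U i))) (t : ∀ i, T.X₂.obj.obj (op (U i)))
    (ha : ∀ i, S.g.hom.app _ (a i) = S.X₃.obj.map (homOfLE le_top).op σ)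
    (ht : ∀ i, T.g.hom.app _ (t i) = T.X₃.obj.map (homOfLE le_top).op s)
    (hat : ∀ i j, φ.τ₂.hom.app _ (S.X₂.obj.map (Opens.infLELeft (U i) (U j)).op (a i) -
        S.X₂.obj.map (Opens.infLERight (U i) (U j)).op (a j)) =
      T.X₂.obj.map (Opens.infLELeft (U i) (U j)).op (t i) -
        T.X₂.obj.map (Opens.infLERight (U i) (U j)).op (t j)) :
    Sheaf.H.map φ.τ₁ 1 (connecting hS σ) = connecting hT s := by
  rw [connecting_naturality hT hS, ← sub_eq_zero, ← connecting_sub, connecting_eq_zero_iff]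
  -- The difference of the classes is the connecting image of φ₃(σ) − s. It vanishes because the
  -- local lifts φ₂(a_i) − t_i agree on overlaps and glue to a global lift r.
  obtain ⟨r, hr, -⟩ := TopCat.Sheaf.existsUnique_gluing' (F := T.X₂) U ⊤
    (fun i => homOfLE le_top) hU (fun i => φ.τ₂.hom.app _ (a i) - t i) (by
      intro i j
      have h := hat i j
      rw [map_sub, NatTrans.naturality_apply, NatTrans.naturality_apply] at h
      refine (map_sub _ _ _).trans (Eq.trans ?_ (map_sub _ _ _).symm)
      exact sub_eq_sub_iff_sub_eq_sub.1 h)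
  refine ⟨r, ?_⟩
  refine TopCat.Sheaf.eq_of_locally_eq' (F := T.X₃) U ⊤ (fun i => homOfLE le_top) hU _ _ fun i => ?_
  have h1 := congrArg (T.g.hom.app (op (U i))) (hr i)
  rw [map_sub, ht, comm₂₃_app, ha, NatTrans.naturality_apply, NatTrans.naturality_apply] at h1
  exact h1.trans (map_sub _ _ _).symm

/-- A class in `H¹` is represented by a cocycle on a fine enough open cover, and any extension with
local splittings that differ by this cocycle has this class. -/
theorem exists_cocycle {F : AbSheaf X} (χ : F.H 1) (O : X → Opens X) (hO : ∀ x, x ∈ O x) :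
    ∃ (U : X → Opens X) (v : ∀ i j, F.obj.obj (op (U i ⊓ U j))),
      (∀ x, x ∈ U x) ∧ (∀ x, U x ≤ O x) ∧
      (∀ i j k, F.obj.map (homOfLE (inf_le_left : U i ⊓ U j ⊓ U k ≤ _)).op (v i j) +
        F.obj.map (homOfLE (inf_le_inf_right _ inf_le_right : U i ⊓ U j ⊓ U k ≤ _)).op (v j k) =
        F.obj.map (homOfLE (inf_le_inf_right _ inf_le_left : U i ⊓ U j ⊓ U k ≤ _)).op (v i k)) ∧
      ∀ (S : ShortComplex (AbSheaf X)) (hS : S.ShortExact) (e : S.X₁ ⟶ F)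
        (σ : S.X₃.obj.obj (op (⊤ : Opens X))) (a : ∀ i, S.X₂.obj.obj (op (U i))),
        (∀ i, S.g.hom.app _ (a i) = S.X₃.obj.map (homOfLE le_top).op σ) →
        (∀ i j, ∃ c : S.X₁.obj.obj (op (U i ⊓ U j)), e.hom.app _ c = v i j ∧
          S.f.hom.app _ c = S.X₂.obj.map (homOfLE inf_le_right).op (a j) -
            S.X₂.obj.map (homOfLE inf_le_left).op (a i)) →
        Sheaf.H.map e 1 (connecting hS σ) = χ := by
  let T : ShortComplex (AbSheaf X) := ShortComplex.mk (Injective.ι F)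
    (Limits.cokernel.π (Injective.ι F)) (Limits.cokernel.condition _)
  have hT : T.ShortExact :=
    { exact := ShortComplex.exact_cokernel _
      mono_f := inferInstanceAs (Mono (Injective.ι F))
      epi_g := inferInstanceAs (Epi (Limits.cokernel.π (Injective.ι F))) }
  have : Injective T.X₂ := inferInstanceAs (Injective (Injective.under F))
  -- From here χ is the class of a section s of the quotient; local lifts t_i, taken inside the
  -- prescribed O i, give v_ij = t_j − t_i.
  obtain ⟨s, rfl⟩ := exists_connecting_eq hT χ
  have hl : ∀ x : X, ∃ (U : Opens X) (t : T.X₂.obj.obj (op U)), x ∈ U ∧ U ≤ O x ∧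
      T.g.hom.app _ t = T.X₃.obj.map (homOfLE le_top).op s := fun x => by
    obtain ⟨U, hU, t, hx, ht⟩ := exists_local_lift hT s (Opens.mem_top x)
    refine ⟨U ⊓ O x, T.X₂.obj.map (homOfLE inf_le_left).op t, ⟨hx, hO x⟩, inf_le_right, ?_⟩
    rw [app_res, ht, res_res]
  choose U t hx hUO ht using hl
  have hv : ∀ i j, ∃ v, T.f.hom.app _ v = T.X₂.obj.map (homOfLE inf_le_right).op (t j) -
      T.X₂.obj.map (homOfLE (inf_le_left : U i ⊓ U j ≤ U i)).op (t i) := fun i j => by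
    refine exists_of_sections_eq_zero hT _ ?_
    rw [map_sub, app_res, app_res, ht, ht, res_res, res_res, sub_self]
  choose v hv using hv
  refine ⟨U, v, hx, hUO, fun i j k => sections_injective hT _ ?_, fun S hS e σ a ha hc => ?_⟩
  · rw [map_add]
    erw [app_res, app_res, app_res, hv, hv, hv]
    simp only [map_sub, res_res]
    abel
  · obtain ⟨φ, hφ⟩ := exists_map_of_injective (T := T) hS e
    subst hφ
    refine connecting_eq_of_local_lifts hT hS φ σ s U
      (fun x _ => Opens.mem_iSup.2 ⟨x, hx x⟩) a t ha ht fun i j => ?_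
    obtain ⟨c, hc, hac⟩ := hc i j
    have h := congrArg (φ.τ₂.hom.app _) hac
    rw [comm₁₂_app, hc, hv] at h
    -- The gluing criterion uses differences i − j, the cocycle j − i.
    rw [← neg_sub, map_neg]
    exact (congrArg Neg.neg h.symm).trans (neg_sub _ _)

/-- Extensions with the same class have local splittings that differ by the same cocycle. -/
theorem exists_matching_lifts {S S' : ShortComplex (AbSheaf X)} (hS : S.ShortExact)
    (hS' : S'.ShortExact) (e : S.X₁ ⟶ S'.X₁) (σ : S.X₃.obj.obj (op (⊤ : Opens X)))
    (σ' : S'.X₃.obj.obj (op (⊤ : Opens X)))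
    (h : Sheaf.H.map e 1 (connecting hS σ) = connecting hS' σ') :
    ∃ (U : X → Opens X) (a : ∀ i, S.X₂.obj.obj (op (U i))) (a' : ∀ i, S'.X₂.obj.obj (op (U i))),
      (∀ x, x ∈ U x) ∧
      (∀ i, S.g.hom.app _ (a i) = S.X₃.obj.map (homOfLE le_top).op σ) ∧
      (∀ i, S'.g.hom.app _ (a' i) = S'.X₃.obj.map (homOfLE le_top).op σ') ∧
      ∀ i j, ∃ c : S.X₁.obj.obj (op (U i ⊓ U j)),
        S.f.hom.app _ c = S.X₂.obj.map (homOfLE inf_le_right).op (a j) -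
          S.X₂.obj.map (homOfLE inf_le_left).op (a i) ∧
        S'.f.hom.app _ (e.hom.app _ c) = S'.X₂.obj.map (homOfLE inf_le_right).op (a' j) -
          S'.X₂.obj.map (homOfLE inf_le_left).op (a' i) := by
  let T : ShortComplex (AbSheaf X) := ShortComplex.mk (Injective.ι S'.X₁)
    (Limits.cokernel.π (Injective.ι S'.X₁)) (Limits.cokernel.condition _)
  have hT : T.ShortExact :=
    { exact := ShortComplex.exact_cokernel _
      mono_f := inferInstanceAs (Mono (Injective.ι S'.X₁))
      epi_g := inferInstanceAs (Epi (Limits.cokernel.π (Injective.ι S'.X₁))) }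
  have : Injective T.X₂ := inferInstanceAs (Injective (Injective.under S'.X₁))
  obtain ⟨φ, hφ⟩ := exists_map_of_injective (T := T) hS e
  obtain ⟨φ', hφ'⟩ := exists_map_of_injective (T := T) hS' (𝟙 S'.X₁)
  have hc : connecting hT (φ.τ₃.hom.app (op ⊤) σ) = connecting hT (φ'.τ₃.hom.app (op ⊤) σ') := by
    rw [← connecting_naturality hT hS φ, ← connecting_naturality hT hS' φ', hφ, hφ']
    exact h.trans (Sheaf.H.map_id_apply _).symm
  -- Both sequences map to the same injective resolution step T, over e and the identity. Equality
  -- of classes means that the images of σ and σ' differ by the image of a global section r of the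
  -- injective sheaf.
  rw [← sub_eq_zero, ← connecting_sub, connecting_eq_zero_iff] at hc
  obtain ⟨r, hr⟩ := hc
  have hl : ∀ x : X, ∃ (U : Opens X) (a : S.X₂.obj.obj (op U)) (a' : S'.X₂.obj.obj (op U)),
      x ∈ U ∧ S.g.hom.app _ a = S.X₃.obj.map (homOfLE le_top).op σ ∧
      S'.g.hom.app _ a' = S'.X₃.obj.map (homOfLE le_top).op σ' ∧
      φ.τ₂.hom.app _ a - φ'.τ₂.hom.app _ a' = T.X₂.obj.map (homOfLE le_top).op r := fun x => by
    obtain ⟨U₁, hU₁, a, hx, ha⟩ := exists_local_lift hS σ (Opens.mem_top x)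
    obtain ⟨U₂, hU₂, a', hx', ha'⟩ := exists_local_lift hS' σ' (Opens.mem_top x)
    set b := S.X₂.obj.map (homOfLE (inf_le_left : U₁ ⊓ U₂ ≤ U₁)).op a
    set b' := S'.X₂.obj.map (homOfLE (inf_le_right : U₁ ⊓ U₂ ≤ U₂)).op a'
    have hb : S.g.hom.app _ b = S.X₃.obj.map (homOfLE le_top).op σ := by
      rw [app_res, ha, res_res]
    have hb' : S'.g.hom.app _ b' = S'.X₃.obj.map (homOfLE le_top).op σ' := by
      rw [app_res, ha', res_res]
    -- The discrepancy φ₂(b) − φ'₂(b') − r dies in the quotient, so it is a section of the kernel;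
    -- adding it to b' makes the two lifts differ exactly by r.
    obtain ⟨v, hv⟩ := exists_of_sections_eq_zero hT (U := op (U₁ ⊓ U₂))
      (φ.τ₂.hom.app _ b - φ'.τ₂.hom.app _ b' - T.X₂.obj.map (homOfLE le_top).op r) (by
        rw [map_sub, map_sub, comm₂₃_app, comm₂₃_app, hb, hb', app_res, app_res, app_res, hr,
          map_sub, sub_self])
    refine ⟨U₁ ⊓ U₂, b, b' + S'.f.hom.app _ v, ⟨hx, hx'⟩, hb, ?_, ?_⟩
    · rw [map_add, zero_app, add_zero, hb']
    · rw [map_add, comm₁₂_app, hφ']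
      refine (congrArg (fun z => φ.τ₂.hom.app _ b - (φ'.τ₂.hom.app _ b' + z)) hv).trans ?_
      abel
  choose U a a' hx ha ha' haa using hl
  refine ⟨U, a, a', hx, ha, ha', fun i j => ?_⟩
  obtain ⟨c, hc⟩ := exists_of_sections_eq_zero hS (U := op (U i ⊓ U j))
    (S.X₂.obj.map (homOfLE inf_le_right).op (a j) - S.X₂.obj.map (homOfLE inf_le_left).op (a i)) (by
      rw [map_sub, app_res, app_res, ha, ha, res_res, res_res, sub_self])
  obtain ⟨c', hc'⟩ := exists_of_sections_eq_zero hS' (U := op (U i ⊓ U j))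
    (S'.X₂.obj.map (homOfLE inf_le_right).op (a' j) -
      S'.X₂.obj.map (homOfLE inf_le_left).op (a' i)) (by
      rw [map_sub, app_res, app_res, ha', ha', res_res, res_res, sub_self])
  -- Compare in the injective sheaf: since r is global, it cancels from the differences over U i ∩ U
  -- j.
  have hcc : e.hom.app _ c = c' := by
    refine sections_injective hT _ ?_
    have h1 := congrArg (φ.τ₂.hom.app _) hc
    have h2 := congrArg (φ'.τ₂.hom.app _) hc'
    have h3 := congrArg (T.X₂.obj.map (homOfLE (inf_le_right : U i ⊓ U j ≤ U j)).op) (haa j)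
    have h4 := congrArg (T.X₂.obj.map (homOfLE (inf_le_left : U i ⊓ U j ≤ U i)).op) (haa i)
    rw [comm₁₂_app, hφ, map_sub, app_res, app_res] at h1
    rw [comm₁₂_app, hφ', map_sub, app_res, app_res] at h2
    rw [map_sub, res_res] at h3 h4
    refine h1.trans (Eq.trans ?_ h2.symm)
    rw [sub_eq_sub_iff_sub_eq_sub, h3, h4]
  exact ⟨c, hc, by rw [hcc]; exact hc'⟩

end SheafSequences

end AffineBundle
-- Classification of extensions by their class
namespace AffineBundle

open Opposite

variable {B : Type w} [NormedAddCommGroup B] [NormedSpace ℂ B]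
  {X : Type u} [TopologicalSpace X] [ChartedSpace B X] {n : ℕ}

/-- A vector mapping to `1` splits an extension of `ℂ`. -/
theorem bijective_coprod_toSpanSingleton {V W : Type*} [AddCommGroup V] [Module ℂ V]
    [AddCommGroup W] [Module ℂ W] {i : V →ₗ[ℂ] W} {p : W →ₗ[ℂ] ℂ} (hi : Function.Injective i)
    (h : Function.Exact i p) {a : W} (ha : p a = 1) :
    Function.Bijective (i.coprod (LinearMap.toSpanSingleton ℂ W a)) := by
  have hp : ∀ y, p (i.coprod (LinearMap.toSpanSingleton ℂ W a) y) = y.2 := fun y => by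
    simp [h.apply_apply_eq_zero, ha]
  constructor
  · refine LinearMap.ker_eq_bot.1 (LinearMap.ker_eq_bot'.2 fun y hy => ?_)
    have h2 : y.2 = 0 := by rw [← hp, hy, map_zero]
    refine Prod.ext (hi ?_) h2
    simpa [h2] using hy
  · intro b
    obtain ⟨v, hv⟩ := (h (b - p b • a)).1 (by simp [ha])
    exact ⟨(v, p b), by simp [hv]⟩

/-- Replaces sections over an open set by functions defined everywhere, so that no subtypes occur in
the fibrewise linear algebra; the values outside are arbitrary. -/
theorem exists_extend {Y : Type*} {E : Y → Type*} [∀ x, Zero (E x)] {U : Set Y}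
    (s : ∀ x : U, E x) : ∃ t : ∀ x, E x, ∀ x : U, t x = s x := by
  classical
  exact ⟨fun x => if h : x ∈ U then s ⟨x, h⟩ else 0, fun x => dif_pos x.2⟩

namespace Extension

variable {V : HolVB.{u, u} B X (Fin n → ℂ)}

/-- Extensions with the same class have isomorphic middle terms. -/
theorem exists_hom_of_cls_eq {S S' : Extension V} (h : S.cls = S'.cls) :
    ∃ f : HolVB.Hom S.W S'.W, (∀ x, Function.Bijective (f.lin x)) ∧
      ∀ x w, (S'.p.lin x (f.lin x w) : ℂ) = S.p.lin x w := by
  obtain ⟨U, a, a', hU, ha, ha', haa⟩ := exists_matching_lifts S.shortExact S'.shortExact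
    (𝟙 V.sheaf) (unitSection B X) (unitSection B X) ((Sheaf.H.map_id_apply _).trans h)
  choose w hw using fun i : X => exists_extend (U := (U i : Set X)) (Subtype.val (a i))
  choose w' hw' using fun i : X => exists_extend (U := (U i : Set X)) (Subtype.val (a' i))
  have hp : ∀ i x, x ∈ U i → S.p.lin x (w i x) = (1 : ℂ) := fun i x hx => by
    rw [hw i ⟨x, hx⟩]
    exact congrFun (congrArg Subtype.val (ha i)) ⟨x, hx⟩
  have hp' : ∀ i x, x ∈ U i → S'.p.lin x (w' i x) = (1 : ℂ) := fun i x hx => by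
    rw [hw' i ⟨x, hx⟩]
    exact congrFun (congrArg Subtype.val (ha' i)) ⟨x, hx⟩
  have hww : ∀ i j x, x ∈ U i → x ∈ U j → ∃ v, S.i.lin x v = w j x - w i x ∧
      S'.i.lin x v = w' j x - w' i x := fun i j x hi hj => by
    obtain ⟨c, hc, hc'⟩ := haa i j
    refine ⟨Subtype.val c ⟨x, hi, hj⟩, ?_, ?_⟩
    · rw [hw i ⟨x, hi⟩, hw j ⟨x, hj⟩]
      exact congrFun (congrArg Subtype.val hc) ⟨x, hi, hj⟩
    · rw [hw' i ⟨x, hi⟩, hw' j ⟨x, hj⟩]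
      exact congrFun (congrArg Subtype.val hc') ⟨x, hi, hj⟩
  have hwh : ∀ i x, x ∈ U i → ContMDiffAt 𝓘(ℂ, B) (𝓘(ℂ, B).prod 𝓘(ℂ, (Fin n → ℂ) × ℂ)) ω
      (fun x => (⟨x, w i x⟩ : S.W.Total)) x := fun i x hx => by
    refine (contMDiffAt_subtype_iff (U := U i) (x := ⟨x, hx⟩)
      (f := fun x => (⟨x, w i x⟩ : S.W.Total))).1 ?_
    simp_rw [hw i]
    exact Subtype.property (a i) ⟨x, hx⟩
  have hwh' : ∀ i x, x ∈ U i → ContMDiffAt 𝓘(ℂ, B) (𝓘(ℂ, B).prod 𝓘(ℂ, (Fin n → ℂ) × ℂ)) ω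
      (fun x => (⟨x, w' i x⟩ : S'.W.Total)) x := fun i x hx => by
    refine (contMDiffAt_subtype_iff (U := U i) (x := ⟨x, hx⟩)
      (f := fun x => (⟨x, w' i x⟩ : S'.W.Total))).1 ?_
    simp_rw [hw' i]
    exact Subtype.property (a' i) ⟨x, hx⟩
  have hbij := fun i x (hx : x ∈ U i) =>
    bijective_coprod_toSpanSingleton (S.injective x) (S.exact x) (hp i x hx)
  have hbij' := fun i x (hx : x ∈ U i) =>
    bijective_coprod_toSpanSingleton (S'.injective x) (S'.exact x) (hp' i x hx)
  -- On the fibre at x, f is the identity on 𝓔 and sends the lift of 1 of index x to its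
  -- counterpart.
  have hf : ∀ x, ∃ f : S.W.E x →ₗ[ℂ] S'.W.E x, Function.Bijective f ∧
      (∀ v, f (S.i.lin x v) = S'.i.lin x v) ∧ f (w x x) = w' x x := fun x => by
    let β := LinearEquiv.ofBijective _ (hbij x x (hU x))
    let β' := LinearEquiv.ofBijective _ (hbij' x x (hU x))
    have key : ∀ y, β.symm.trans β' (β y) = β' y := fun y =>
      congrArg β' (β.symm_apply_apply y)
    refine ⟨(β.symm.trans β').toLinearMap, (β.symm.trans β').bijective, fun v => ?_, ?_⟩
    · simpa [β, β'] using key (v, 0)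
    · simpa [β, β'] using key (0, 1)
  choose f hfb hfi hfw using hf
  -- The index does not matter: w_x − w_i and w'_x − w'_i come from the same vector of 𝓔.
  have hfw' : ∀ i x, x ∈ U i → f x (w i x) = w' i x := fun i x hi => by
    obtain ⟨v, hv, hv'⟩ := hww i x x hi (hU x)
    rw [eq_sub_iff_add_eq, ← eq_sub_iff_add_eq'] at hv hv'
    rw [hv, hv', map_sub, hfi, hfw]
  refine ⟨⟨f, HolVB.contMDiff_of_frames _ _ f fun x₀ => ?_⟩, hfb, fun x y => ?_⟩
  · obtain ⟨O, hx₀, b, hb, hbh⟩ := V.exists_frame x₀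
    have hO : ∀ᶠ x in nhds x₀, x ∈ O ∧ x ∈ U x₀ :=
      Filter.Eventually.and (O.2.mem_nhds hx₀) ((U x₀).2.mem_nhds (hU x₀))
    -- A frame of 𝓔 completed by the lift of fixed index x₀ is a holomorphic frame of 𝓕, and f sends
    -- it to its analogue in the other extension.
    refine ⟨fun x => ((S.i.lin x).comp (b x)).coprod (LinearMap.toSpanSingleton ℂ _ (w x₀ x)),
      hO.mono fun x hx => ?_, fun v => ?_, fun v => ?_⟩
    · have h1 := (hbij x₀ x hx.2).comp ((hb x hx.1).prodMap (Function.bijective_id (α := ℂ)))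
      exact h1
    · exact S.W.contMDiffAt_add (S.i.holomorphic'.contMDiffAt.comp x₀ (hbh v.1 x₀ hx₀))
        (S.W.contMDiffAt_smul contMDiffAt_const (hwh x₀ x₀ (hU x₀)))
    · refine (S'.W.contMDiffAt_add (S'.i.holomorphic'.contMDiffAt.comp x₀ (hbh v.1 x₀ hx₀))
        (S'.W.contMDiffAt_smul (contMDiffAt_const (c := v.2))
          (hwh' x₀ x₀ (hU x₀)))).congr_of_eventuallyEq (hO.mono fun x hx => ?_)
      refine congrArg (TotalSpace.mk x) ?_
      simp [hfi, hfw' x₀ x hx.2]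
  · obtain ⟨y, rfl⟩ := (hbij x x (hU x)).2 y
    have h1 := hp x x (hU x)
    have h2 := hp' x x (hU x)
    have h3 := (S.exact x).apply_apply_eq_zero y.1
    have h4 := (S'.exact x).apply_apply_eq_zero y.1
    rw [LinearMap.coprod_apply, LinearMap.toSpanSingleton_apply, map_add, hfi, map_smul, hfw,
      map_add, map_add, map_smul, map_smul, h3, h4]
    exact congrArg (fun z : ℂ => 0 + y.2 • z) (h2.trans h1.symm)

/-- Every class in `H¹` is the class of an extension associated with a principal bundle. -/
theorem exists_of_cls [IsManifold 𝓘(ℂ, B) ω X] (χ : (H1 B X (Fin n → ℂ)).obj V) :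
    ∃ (S : Extension V) (Q : PrincipalAff B X n), Nonempty (S.Evaluation Q) ∧ S.cls = χ := by
  let e : ∀ i : X, Trivialization (Fin n → ℂ) (TotalSpace.proj (F := Fin n → ℂ) (E := V.E)) :=
    fun i => trivializationAt (Fin n → ℂ) V.E i
  obtain ⟨U, s, hU, hUO, hs, hχ⟩ := exists_cocycle (X := TopCat.of X) (F := V.sheaf) χ
    (fun i => ⟨(e i).baseSet, (e i).open_baseSet⟩) (mem_baseSet_trivializationAt (Fin n → ℂ) V.E)
  choose v hv using fun i j : X =>
    exists_extend (U := ((U i ⊓ U j : Opens (TopCat.of X)) : Set X)) (Subtype.val (s i j))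
  have hvh : ∀ i j x, x ∈ U i → x ∈ U j → ContMDiffAt 𝓘(ℂ, B) (𝓘(ℂ, B).prod 𝓘(ℂ, Fin n → ℂ)) ω
      (fun x => (⟨x, v i j x⟩ : V.Total)) x := fun i j x hi hj => by
    refine (contMDiffAt_subtype_iff (U := U i ⊓ U j) (x := ⟨x, hi, hj⟩)
      (f := fun x => (⟨x, v i j x⟩ : V.Total))).1 ?_
    simp_rw [hv i j]
    exact Subtype.property (s i j) ⟨x, hi, hj⟩
  have hvc : ∀ i j k x, x ∈ U i → x ∈ U j → x ∈ U k → v i j x + v j k x = v i k x := by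
    intro i j k x hi hj hk
    rw [hv i j ⟨x, hi, hj⟩, hv j k ⟨x, hj, hk⟩, hv i k ⟨x, hi, hk⟩]
    exact congrFun (congrArg Subtype.val (hs i j k)) ⟨x, ⟨hi, hj⟩, hk⟩
  have hv0 : ∀ i x, x ∈ U i → v i i x = 0 := fun i x hi => by
    simpa using hvc i i i x hi hi hi
  let L : ∀ i x : X, V.E x →ₗ[ℂ] (Fin n → ℂ) := fun i x => (e i).linearMapAt ℂ x
  have hL : ∀ i x, x ∈ U i → ∀ z, (e i).symmₗ ℂ x (L i x z) = z := fun i x hi z =>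
    (e i).symmₗ_linearMapAt (hUO i hi) z
  have hL' : ∀ i x, x ∈ U i → ∀ z, L i x ((e i).symmₗ ℂ x z) = z := fun i x hi z =>
    (e i).linearMapAt_symmₗ (hUO i hi) z
  have hg : ∀ i j x, ∃ g : Aff n, x ∈ U i → x ∈ U j →
      (∀ z, g.lin.1 (L j x z) = L i x z) ∧ g.trans = L i x (v i j x) := fun i j x => by
    by_cases h : x ∈ U i ∧ x ∈ U j
    · let α := (((e j).linearEquivAt ℂ x (hUO j h.2)).symm.trans
        ((e i).linearEquivAt ℂ x (hUO i h.1))).toContinuousLinearEquiv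
      refine ⟨(ContinuousLinearEquiv.toUnit α, L i x (v i j x)), fun hi hj => ⟨fun z => ?_, rfl⟩⟩
      have h1 : ∀ i (hi : x ∈ U i) z, L i x z = (e i).linearEquivAt ℂ x (hUO i hi) z :=
        fun i hi z => by
          change (e i).linearMapAt ℂ x z = _
          rw [(e i).linearMapAt_def_of_mem (hUO i hi)]
          rfl
      rw [h1 i hi z, h1 j hj z]
      exact congrArg ((e i).linearEquivAt ℂ x (hUO i hi))
        (((e j).linearEquivAt ℂ x (hUO j hj)).symm_apply_apply z)
    · exact ⟨1, fun hi hj => (h ⟨hi, hj⟩).elim⟩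
  choose g hg using hg
  have hcoord : ∀ i x, x ∈ U i → ∀ {t : ∀ y, V.E y},
      ContMDiffAt 𝓘(ℂ, B) (𝓘(ℂ, B).prod 𝓘(ℂ, Fin n → ℂ)) ω (fun y => (⟨y, t y⟩ : V.Total)) x →
      ContMDiffAt 𝓘(ℂ, B) 𝓘(ℂ, Fin n → ℂ) ω (fun y => L i y (t y)) x := fun i x hi t ht =>
    ((V.contMDiffAt_total_iff (hUO i hi)).1 ht).2
  let c : AffCocycle B X n :=
    { U := fun i => U i
      isOpen_U := fun i => (U i).2
      mem_U := hU
      g := g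
      holomorphic := fun i j x hi hj => by
        have hn : ∀ᶠ y in nhds x, y ∈ U i ∧ y ∈ U j :=
          Filter.Eventually.and ((U i).2.mem_nhds hi) ((U j).2.mem_nhds hj)
        refine Aff.contMDiffAt_iff.2 ⟨contMDiffAt_clm_of_apply fun z => ?_, ?_⟩
        · refine (hcoord i x hi (V.contMDiffOn_localFrame j contMDiffAt_id
            (contMDiffAt_const (c := z)) (hUO j hj))).congr_of_eventuallyEq ?_
          filter_upwards [hn] with y hy
          have h1 := (hg i j y hy.1 hy.2).1 ((e j).symmₗ ℂ y z)
          rwa [hL' j y hy.2] at h1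
        · refine (hcoord i x hi (hvh i j x hi hj)).congr_of_eventuallyEq ?_
          filter_upwards [hn] with y hy
          exact (hg i j y hy.1 hy.2).2
      g_self := fun i x hi => by
        refine Aff.ext (Units.ext (ContinuousLinearMap.ext fun z => ?_)) ?_
        · have h1 := (hg i i x hi hi).1 ((e i).symmₗ ℂ x z)
          rwa [hL' i x hi] at h1
        · rw [(hg i i x hi hi).2, hv0 i x hi, map_zero]
          rfl
      g_comp := fun i j k x hi hj hk => by
        refine Aff.ext (Units.ext (ContinuousLinearMap.ext fun z => ?_)) ?_
        · have h1 := (hg j k x hj hk).1 ((e k).symmₗ ℂ x z)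
          have h2 := (hg i k x hi hk).1 ((e k).symmₗ ℂ x z)
          rw [hL' k x hk] at h1 h2
          change (g i j x).lin.1 ((g j k x).lin.1 z) = _
          rw [h1, h2, (hg i j x hi hj).1]
        -- The translation part of g_ij g_jk is e_i e_j⁻¹(e_j(v_jk)) + e_i(v_ij) = e_i(v_ij + v_jk).
        · rw [Aff.mul_trans, (hg j k x hj hk).2, (hg i j x hi hj).1, (hg i j x hi hj).2,
            (hg i k x hi hk).2, ← map_add, add_comm, hvc i j k x hi hj hk] }
  let θ : ∀ x, V.E x ≃ₗ[ℂ] (Fin n → ℂ) := fun x =>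
    LinearEquiv.ofBijective (L x x) ⟨Function.LeftInverse.injective (hL x x (hU x)),
      Function.RightInverse.surjective (hL' x x (hU x))⟩
  have hθ : ∀ j (z : V.Total), z.proj ∈ c.U j → ContMDiffAt (𝓘(ℂ, B).prod 𝓘(ℂ, Fin n → ℂ))
      𝓘(ℂ, Fin n → ℂ) ω
      (fun z : V.Total => (c.g j z.proj z.proj).lin.1 (θ z.proj z.snd)) z := fun j z hz => by
    have h1 := (V.contMDiffAt_total_iff (a := fun z : V.Total => z.proj) (s := fun z => z.snd)
      (hUO j hz)).1 contMDiffAt_id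
    refine h1.2.congr_of_eventuallyEq ?_
    filter_upwards [h1.1.continuousAt.preimage_mem_nhds ((U j).2.mem_nhds hz)] with y hy
    exact (hg j y.proj y.proj hy (hU y.proj)).1 y.snd
  refine ⟨c.extension V θ hθ, c.principal, ⟨c.evaluation V θ hθ⟩, ?_⟩
  -- The local lift of 1 over U i is the vector (0, 1) in the trivialization of index i, stored at y
  -- in the coordinates of index y.
  have hsec : ∀ i, (c.extension V θ hθ).W.IsHolSection (U i)
      (fun y => ULift.up ((c.g y i y).act (0, 1))) := fun i x => by
    refine (c.toLinear.contMDiffAt_total_iff (a := fun y : U i => y.1)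
      (v := fun y => (c.g y i y).act (0, 1)) i x.2).2 ⟨contMDiff_subtype_val.contMDiffAt, ?_⟩
    refine (contMDiffAt_const (c := ((0 : Fin n → ℂ), (1 : ℂ)))).congr_of_eventuallyEq
      (Filter.Eventually.of_forall fun y => ?_)
    refine (Aff.act_mul _ _ _).symm.trans ?_
    rw [c.g_inv y.2 (c.mem_U y), Aff.one_act]
  refine (Sheaf.H.map_id_apply _).symm.trans (hχ (c.extension V θ hθ).complex
    (c.extension V θ hθ).shortExact (𝟙 V.sheaf) (unitSection B X) (fun i => ⟨_, hsec i⟩)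
    (fun i => rfl) fun i j => ⟨s i j, rfl, Subtype.ext (funext fun y => ?_)⟩)
  have hi : y.1 ∈ U i := y.2.1
  have hj : y.1 ∈ U j := y.2.2
  have hyy := hU y.1
  change (ULift.up (L y.1 y.1 ((s i j).1 y), (0 : ℂ)) : ULift.{u} ((Fin n → ℂ) × ℂ)) =
    ULift.up ((g y.1 j y.1).act (0, 1)) - ULift.up ((g y.1 i y.1).act (0, 1))
  -- In the coordinates of index y, the lifts of indices j and i differ by e_y(v_yj) − e_y(v_yi) =
  -- e_y(v_ij). Thus their differences are the given cocycle.
  have h1 : L y.1 y.1 ((s i j).1 y) = (g y.1 j y.1).trans - (g y.1 i y.1).trans := by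
    rw [(hg _ _ _ hyy hi).2, (hg _ _ _ hyy hj).2, ← hvc y.1 i j y.1 hyy hi hj, ← map_sub,
      add_sub_cancel_left]
    exact congrArg _ (hv i j y).symm
  refine ULift.ext _ _ (Prod.ext ?_ ?_)
  · rw [h1]
    simp [Aff.act]
  · simp [Aff.act]

end Extension

end AffineBundle
-- The bijection of isomorphism classes
open AffineBundle in
/-- Isomorphism classes of holomorphic principal `Af_n(ℂ)`-bundles on a complex manifold `X` are in
bijection with isomorphism classes of pairs `(𝓔, χ)`, the class of `P` corresponding to that of
`(𝓔, χ)` exactly when the extension of `𝓞_X` attached to `P` is an extension by `𝓔` of class `χ`. -/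
theorem proposition2p4 {B : Type w} [NormedAddCommGroup B] [NormedSpace ℂ B]
    [FiniteDimensional ℂ B] {X : Type u} [TopologicalSpace X] [ChartedSpace B X]
    [IsManifold 𝓘(ℂ, B) ω X] (n : ℕ) :
    ∃ Φ : Quotient (isIsomorphicSetoid (PrincipalAff B X n)) ≃
        Quotient (isIsomorphicSetoid (Pairs B X n)),
      ∀ (P : PrincipalAff B X n) (x : Pairs B X n),
        Φ (Quotient.mk _ P) = Quotient.mk _ x ↔
          ∃ S : Extension x.1, S.IsAssociated P ∧ S.cls = x.2 := by
  let R : PrincipalAff B X n → Pairs B X n → Prop := fun P x =>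
    ∃ S : Extension x.1, S.IsAssociated P ∧ S.cls = x.2
  have total : ∀ P, ∃ x, R P x := fun P => by
    obtain ⟨V, S, hA⟩ := P.exists_evaluation
    exact ⟨⟨V, S.cls⟩, S, Extension.isAssociated_iff.2 hA, rfl⟩
  have surj : ∀ x, ∃ P, R P x := fun x => by
    obtain ⟨S, Q, hA, h⟩ := Extension.exists_of_cls x.2
    exact ⟨Q, S, Extension.isAssociated_iff.2 hA, h⟩
  have unique : ∀ P P' x x', R P x → R P' x' → Nonempty (P ≅ P') → Nonempty (x ≅ x') := by
    rintro P P' x x' ⟨S, hA, hS⟩ ⟨S', hA', hS'⟩ ⟨φ⟩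
    obtain ⟨A⟩ := Extension.isAssociated_iff.1 hA
    obtain ⟨A'⟩ := Extension.isAssociated_iff.1 hA'
    obtain ⟨A''⟩ := A.exists_of_iso φ
    obtain ⟨ψ, hψ⟩ := A''.exists_kernel_iso A'
    exact ⟨CategoryOfElements.isoMk x x' ψ (by rw [← hS, ← hS', hψ])⟩
  have trans : ∀ P x x', R P x → Nonempty (x ≅ x') → R P x' := by
    rintro P x x' ⟨S, hA, hS⟩ ⟨ψ⟩
    obtain ⟨A⟩ := Extension.isAssociated_iff.1 hA
    let ψ' : x.1 ≅ x'.1 := (CategoryOfElements.π _).mapIso ψ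
    -- Changing the kernel leaves the middle term and its projection untouched, so the same
    -- evaluation maps serve.
    refine ⟨S.ofIso ψ', Extension.isAssociated_iff.2 ⟨⟨A.ev, A.holomorphic, A.ev_smul, A.p_ev⟩⟩, ?_⟩
    rw [Extension.cls_ofIso, hS]
    exact ψ.hom.2
  have inj : ∀ P P' x, R P x → R P' x → Nonempty (P ≅ P') := by
    rintro P P' x ⟨S, hA, hS⟩ ⟨S', hA', hS'⟩
    obtain ⟨A⟩ := Extension.isAssociated_iff.1 hA
    obtain ⟨A'⟩ := Extension.isAssociated_iff.1 hA'
    obtain ⟨f, hf, hp⟩ := Extension.exists_hom_of_cls_eq (hS.trans hS'.symm)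
    exact (A.map f hf hp).nonempty_iso A'
  choose F hF using total
  let Φ : Quotient (isIsomorphicSetoid (PrincipalAff B X n)) →
      Quotient (isIsomorphicSetoid (Pairs B X n)) :=
    Quotient.map F fun P P' h => unique P P' _ _ (hF P) (hF P') h
  -- The chosen pair F P is irrelevant: the pairs related to P form exactly one isomorphism class.
  have key : ∀ P x, Φ (Quotient.mk _ P) = Quotient.mk _ x ↔ R P x := fun P x =>
    ⟨fun h => trans P _ _ (hF P) (Quotient.exact h),
      fun h => Quotient.sound (unique P P _ _ (hF P) h ⟨Iso.refl P⟩)⟩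
  refine ⟨Equiv.ofBijective Φ ⟨?_, ?_⟩, key⟩
  · rintro ⟨P⟩ ⟨P'⟩ h
    exact Quotient.sound (inj P P' _ ((key P (F P')).1 h) (hF P'))
  · rintro ⟨x⟩
    obtain ⟨P, hP⟩ := surj x
    exact ⟨Quotient.mk _ P, (key P x).2 hP⟩
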